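/- **Setting.** Let $u_k^\star>0$ with $u_k^\star\downarrow 0$, $\mathcal X=\prod_{k\ge1}[-u_k^\star,u_k^\star]$, let $\mu_0$ be the product of the uniform distributions on the intervals $[-u_k^\star,u_k^\star]$, and let $\Pi_j u=(u_1,\dots,u_j,0,0,\dots)$, $\mathcal X_j=\Pi_j\mathcal X$, $\mu_{0,j}=(\Pi_j)_*\mu_0$. Let $y\in\mathbb R^d$, $G:\mathcal X\to\mathbb R^d$, and let $G_j:\mathcal X\to\mathbb R^d$ be measurable with $G_j=G_j\circ\Pi_j$. Let the posterior $\mu^y$ be given by $\frac{d\mu^y}{d\mu_0}(u)\propto\exp(-\tfrac12\|y-G(u)\|^2)$, and put $\alpha_j(x,\xi)=1\wedge\exp\big(\tfrac12\|y-G_j(x)\|^2-\tfrac12\|y-G_j(\xi)\|^2\big)$. **Assumptions.** For some $\beta,\kappa>1$: (1) $\sup_{u}\|G_j(u)-G(u)\|\lesssim j^{-\beta}$ $(j\ge1)$ and $\sup_u\|G(u)\|<\infty$; (2) $f:\mathcal X\to\mathbb R$ is bounded and measurable, $\sup_x|f(\Pi_jx)-f(\Pi_{\tilde j}x)|\lesssim(j\wedge\tilde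 j)^{-\kappa/2}$ $(j,\tilde j\ge1)$, and $f(\Pi_jx)\to f(x)$ as $j\to\infty$ for every $x\in\mathcal X$; (3) one step of the chain in dimension $j\geq 1$ costs $s(j)\lesssim j^\theta$, where $\theta<r:=\beta\wedge\kappa$. **Algorithm.** Let $\alpha_\star\in(0,1)$ satisfy $\alpha_j(x,\xi)\ge\alpha_\star$ for all $j\ge1$ and $x,\xi\in\mathcal X$. Let $(a_i)_{i\ge0}$, $(j_i)_{i\ge0}$ be nondecreasing sequences of integers, $a_i\ge0$, $j_i\ge1$, and let $x_0\in\mathcal X_{j_0}$. A *plain step* in dimension $j$ moves $x$ to a proposal $\xi\sim\mu_{0,j}$ with probability $\alpha_j(x,\xi)$ and otherwise stays at $x$. $\Delta_0=f(X)$, where $X$ is the state after $a_0$ plain steps in dimension $j_0$ from $x_0$. For $i\ge1$, the top chain first makes $a_i-a_{i-1}$ plain steps in dimension $j_i$ from $x_0$. Then the bottom chain is started at $x_0$, and both chains make $a_{i-1}$ steps; each of these uses common fresh independent inputs $U_1,U_2\sim\mathrm U[0,1]$, $\xi_1,\xi_2\sim\mu_{0,j_i}$. The top chain moves from $x$ to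 $\xi_1$ if $U_1\le\alpha_\star$, to $\xi_2$ if $U_1>\alpha_\star$ and $U_2\le\frac{\alpha_{j_i}(x,\xi_2)-\alpha_\star}{1-\alpha_\star}$, and stays at $x$ otherwise; the bottom chain follows the same rule with $\Pi_{j_{i-1}}\xi_l$ in place of $\xi_l$ and $\alpha_{j_{i-1}}$ in place of $\alpha_{j_i}$. $\Delta_i$ is the value of $f$ at the final state of the top chain minus that at the final state of the bottom chain. The $\Delta_i$ are generated independently, $N$ is a random variable in $\{0,1,2,\dots\}$ independent of all of them with $\mathbb P(N\ge i)>0$ for all $i$, and $$Z=\sum_{i=0}^N\frac{\Delta_i}{\mathbb P(N\ge i)} .$$ The computing time of $Z$ is $\tau=\sum_{i=0}^Nt_i$ with $t_0=a_0s(j_0)$ and $t_i=a_is(j_i)+a_{i-1}s(j_{i-1})$ for $i\ge1$. **Theorem.** $\mu^y$ is a probability measure, and an $\alpha_\star$ as above exists. For every such $\alpha_\star$, there are sequences $a_i\to\infty$, $j_i\to\infty$ and a distribution of $N$, as above, such that, for every $x_0\in\mathcal X_{j_0}$, $Z$ is an unbiased estimator of $\mathbb E_{\mu^y}[f]$ with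 finite variance and finite expected computing time $\mathbb E\tau<\infty$. More precisely, put $c_\star=-\log(1-\alpha_\star)$ and let $q>\frac3{r-\theta}$. Then $1+\theta q<rq-2$, and for every $t\in(1+\theta q,\,rq-2)$ this holds for every choice with $j_i=i^q$ up to rounding to an integer (that is, $|j_i-i^q|<1$) for $i\ge1$, $a_i\sim\frac{q\beta}{c_\star}\log i$ as $i\to\infty$, and $\mathbb P(N\ge i)=b\,i^{-t}$ for $i\ge1$ with a constant $b>0$; such choices exist whenever $t>0$ (automatic if $\theta\ge0$). -/

import Mathlib

open MeasureTheory ProbabilityTheory Filter Topology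

noncomputable section

/-- The setup of the Bayesian inverse problem `y = G(u) + η`, `η ∼ N(0, I)` in `ℝ^d`, with a uniform
series prior. The index `k = 0, 1, 2, …` stands for the coordinates number `1, 2, 3, …`;
`Gj j` is the level-`j` approximation of the observation operator, which depends on `u` only through
its first `j` coordinates. -/
structure InverseProblem (d : ℕ) where
  /-- half-widths of the coordinate intervals -/
  ustar : ℕ → ℝ
  ustar_pos : ∀ k, 0 < ustar k
  ustar_anti : Antitone ustar
  ustar_lim : Tendsto ustar atTop (𝓝 0)
  /-- the data -/
  y : EuclideanSpace ℝ (Fin d)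
  /-- the observation operator -/
  G : ((k : ℕ) → Set.Icc (-ustar k) (ustar k)) → EuclideanSpace ℝ (Fin d)
  /-- its approximations -/
  Gj : ℕ → ((k : ℕ) → Set.Icc (-ustar k) (ustar k)) → EuclideanSpace ℝ (Fin d)
  Gj_measurable : ∀ j, Measurable (Gj j)
  Gj_dep : ∀ (j : ℕ) (u v : (k : ℕ) → Set.Icc (-ustar k) (ustar k)),
    (∀ k < j, u k = v k) → Gj j u = Gj j v

namespace InverseProblem

variable {d : ℕ} (P : InverseProblem d)

/-- The state space `𝒳 = ∏ₖ [-uₖ*, uₖ*]`. -/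
abbrev X : Type := (k : ℕ) → Set.Icc (-P.ustar k) (P.ustar k)

/-- The projection `Π_j x = (x₁, …, x_j, 0, 0, …)`. The space `𝒳_j` is the set of the `x` with
`Π_j x = x`. -/
def proj (j : ℕ) (x : P.X) : P.X := fun k =>
  if k < j then x k else ⟨0, (neg_neg_of_pos (P.ustar_pos k)).le, (P.ustar_pos k).le⟩

/-- The uniform distribution on `[-uₖ*, uₖ*]`. -/
def uniformCoord (k : ℕ) : Measure (Set.Icc (-P.ustar k) (P.ustar k)) :=
  (volume (Set.Icc (-P.ustar k) (P.ustar k)))⁻¹ • Measure.comap Subtype.val volume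

instance (k : ℕ) : IsProbabilityMeasure (P.uniformCoord k) := by
  constructor
  rw [uniformCoord, Measure.smul_apply, smul_eq_mul,
    (MeasurableEmbedding.subtype_coe measurableSet_Icc).comap_apply, Set.image_univ,
    Subtype.range_coe, Real.volume_Icc]
  refine ENNReal.inv_mul_cancel ?_ ENNReal.ofReal_ne_top
  have := P.ustar_pos k
  simp only [ne_eq, ENNReal.ofReal_eq_zero, not_le]
  linarith

/-- The prior `μ₀`, under which the coordinates are independent and uniform. -/
def prior : Measure P.X := Measure.infinitePi P.uniformCoord

instance : IsProbabilityMeasure P.prior := by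
  unfold prior; infer_instance

lemma measurable_proj (j : ℕ) : Measurable (P.proj j) := by
  refine measurable_pi_lambda _ fun k => ?_
  unfold proj
  split_ifs
  · exact measurable_pi_apply k
  · exact measurable_const

/-- The projected prior `μ_{0,j}`. -/
def projPrior (j : ℕ) : Measure P.X := P.prior.map (P.proj j)

instance (j : ℕ) : IsProbabilityMeasure (P.projPrior j) :=
  Measure.isProbabilityMeasure_map (P.measurable_proj j).aemeasurable

/-- The posterior `μ^y`, with density proportional to `exp(-½‖y - G(u)‖²)` with respect to `μ₀`. -/
def posterior : Measure P.X := P.prior.tilted fun u => -(1 / 2) * ‖P.y - P.G u‖ ^ 2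

/-- The acceptance probability `α_j(x, ξ)` of the independence sampler in dimension `j`. -/
def accept (j : ℕ) (x ξ : P.X) : ℝ :=
  min 1 (Real.exp ((1 / 2) * ‖P.y - P.Gj j x‖ ^ 2 - (1 / 2) * ‖P.y - P.Gj j ξ‖ ^ 2))

/-- `G_j` converges to `G` uniformly at rate `j^{-β}`, and `G` is bounded. -/
def ForwardRate (β : ℝ) : Prop :=
  (∃ C : ℝ, ∀ j : ℕ, 1 ≤ j → ∀ u : P.X, ‖P.Gj j u - P.G u‖ ≤ C * (j : ℝ) ^ (-β)) ∧
  (∃ M : ℝ, ∀ u : P.X, ‖P.G u‖ ≤ M)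

/-- `|f(Π_j x) - f(Π_{j'} x)| ≲ (j ∧ j')^{-κ/2}`, uniformly in `x`, together with the limit case
`f(Π_j x) → f(x)` as `j → ∞`. -/
def ObservableRate (f : P.X → ℝ) (κ : ℝ) : Prop :=
  (∃ C : ℝ, ∀ j j' : ℕ, 1 ≤ j → 1 ≤ j' → ∀ x : P.X,
    |f (P.proj j x) - f (P.proj j' x)| ≤ C * (min (j : ℝ) (j' : ℝ)) ^ (-(κ / 2))) ∧
  (∀ x : P.X, Tendsto (fun j : ℕ => f (P.proj j x)) atTop (𝓝 (f x)))

/-- `αs ∈ (0, 1)` is a lower bound of the acceptance probabilities in all dimensions. -/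
def IsAcceptBound (αs : ℝ) : Prop :=
  0 < αs ∧ αs < 1 ∧ ∀ j : ℕ, 1 ≤ j → ∀ x ξ : P.X, αs ≤ P.accept j x ξ

/-- The random input `W = (U₁, U₂, ξ₁, ξ₂)` of one step. -/
abbrev Seed : Type := unitInterval × unitInterval × P.X × P.X

/-- The law of the random input in dimension `j`: independent `U₁, U₂ ∼ U[0,1]` and
`ξ₁, ξ₂ ∼ μ_{0,j}`. -/
def seedLaw (j : ℕ) : Measure P.Seed :=
  (volume : Measure unitInterval).prod
    ((volume : Measure unitInterval).prod ((P.projPrior j).prod (P.projPrior j)))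

instance (j : ℕ) : IsProbabilityMeasure (P.seedLaw j) := by
  unfold seedLaw; infer_instance

open Classical in
/-- One step of the (plain) independence sampler in dimension `j`: the proposal `ξ₁` is accepted with
probability `α_j(x, ξ₁)`, by means of `U₁`. -/
def plainStep (j : ℕ) (x : P.X) (w : P.Seed) : P.X :=
  if (w.1 : ℝ) ≤ P.accept j x w.2.2.1 then w.2.2.1 else x

open Classical in
/-- The random function `φ` that drives the top chain when `j = j_i`: for `U₁ ≤ αs` move to `ξ₁`,
otherwise propose `ξ₂` and accept it if `U₂ ≤ (α_j(x, ξ₂) - αs) / (1 - αs)`. -/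
def coupledStepTop (αs : ℝ) (j : ℕ) (x : P.X) (w : P.Seed) : P.X :=
  if (w.1 : ℝ) ≤ αs then w.2.2.1
  else if (w.2.1 : ℝ) ≤ (P.accept j x w.2.2.2 - αs) / (1 - αs) then w.2.2.2
  else x

/-- The random function that drives the bottom chain when `j = j_{i-1}`: the same as for the
top chain, but in dimension `j` and with the proposals projected by `Π_j`. -/
def coupledStepBottom (αs : ℝ) (j : ℕ) (x : P.X) (w : P.Seed) : P.X :=
  P.coupledStepTop αs j x (w.1, w.2.1, P.proj j w.2.2.1, P.proj j w.2.2.2)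

/-- `chain step w x n` is the state after `n` steps from `x`, driven by `w 0, …, w (n - 1)`. -/
def chain (step : P.X → P.Seed → P.X) (w : ℕ → P.Seed) (x : P.X) : ℕ → P.X
  | 0 => x
  | n + 1 => step (chain step w x n) (w n)

/-- `Δ_i` as a function of the inputs `w 0, w 1, …` of the successive steps at level `i`.
For `i ≥ 1` the top chain makes `a_i - a_{i-1}` plain steps from `x₀`; then the bottom chain is
started in `x₀`, and both make `a_{i-1}` steps with common inputs. -/
def delta (αs : ℝ) (a j : ℕ → ℕ) (f : P.X → ℝ) (x₀ : P.X) : ℕ → (ℕ → P.Seed) → ℝ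
  | 0, w => f (P.chain (P.plainStep (j 0)) w x₀ (a 0))
  | i + 1, w =>
    let b := a (i + 1) - a i
    let w' : ℕ → P.Seed := fun m => w (b + m)
    let top := P.chain (P.coupledStepTop αs (j (i + 1))) w'
      (P.chain (P.plainStep (j (i + 1))) w x₀ b) (a i)
    let bottom := P.chain (P.coupledStepBottom αs (j i)) w' x₀ (a i)
    f top - f bottom

/-- Sample points: the inputs of all steps (`(i, m)` is step number `m` at level `i`) and the
value of the truncation index `N`. -/
abbrev Sample : Type := (ℕ × ℕ → P.Seed) × ℕ

/-- The law of the algorithm's randomness: all inputs are independent, those at level `i` have law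
`seedLaw (j i)`, and `N` is independent of them with law `ν`. -/
def sampleLaw (j : ℕ → ℕ) (ν : Measure ℕ) : Measure P.Sample :=
  (Measure.infinitePi fun p : ℕ × ℕ => P.seedLaw (j p.1)).prod ν

/-- The estimator `Z = ∑_{i=0}^N Δ_i / P(N ≥ i)`. -/
def estimator (αs : ℝ) (a j : ℕ → ℕ) (ν : Measure ℕ) (f : P.X → ℝ) (x₀ : P.X)
    (ω : P.Sample) : ℝ :=
  ∑ i ∈ Finset.range (ω.2 + 1),
    P.delta αs a j f x₀ i (fun m => ω.1 (i, m)) / ν.real (Set.Ici i)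

/-- The computing time `t_i` of `Δ_i` when one step of the chain in dimension `n` costs `s n`:
`a_i` steps of the top chain and `a_{i-1}` steps of the bottom chain. -/
def levelCost (s : ℕ → NNReal) (a j : ℕ → ℕ) : ℕ → ℝ
  | 0 => a 0 * s (j 0)
  | i + 1 => a (i + 1) * s (j (i + 1)) + a i * s (j i)

/-- The computing time `τ = ∑_{i=0}^N t_i` of the estimator. -/
def totalCost (s : ℕ → NNReal) (a j : ℕ → ℕ) (ω : P.Sample) : ℝ :=
  ∑ i ∈ Finset.range (ω.2 + 1), levelCost s a j i

/-- For every starting point in `𝒳_{j_0}`, the estimator is square integrable (so it has finite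
variance), it is unbiased for the posterior expectation of `f`, and its expected computing time
is finite. -/
def Works (αs : ℝ) (s : ℕ → NNReal) (f : P.X → ℝ) (a j : ℕ → ℕ) (ν : Measure ℕ) : Prop :=
  ∀ x₀ : P.X, P.proj (j 0) x₀ = x₀ →
    MemLp (P.estimator αs a j ν f x₀) 2 (P.sampleLaw j ν) ∧
    ∫ ω, P.estimator αs a j ν f x₀ ω ∂(P.sampleLaw j ν) = ∫ u, f u ∂P.posterior ∧
    Integrable (P.totalCost s a j) (P.sampleLaw j ν)

end InverseProblem

/-- Admissible parameters of the algorithm: nondecreasing integer sequences `a`, `j` tending to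
infinity with `j ≥ 1`, and a law `ν` of `N` with `P(N ≥ i) > 0` for all `i`. -/
structure IsParameterChoice (a j : ℕ → ℕ) (ν : Measure ℕ) : Prop where
  a_mono : Monotone a
  a_lim : Tendsto a atTop atTop
  j_mono : Monotone j
  j_lim : Tendsto j atTop atTop
  j_pos : 1 ≤ j 0
  prob : IsProbabilityMeasure ν
  tail_pos : ∀ i : ℕ, 0 < ν.real (Set.Ici i)

/-- The polynomial choice: `j_i = i^q` up to rounding to an integer, `a_i ∼ (q β / c) log i`, and
`P(N ≥ i)` proportional to `i^{-t}` (for `i ≥ 1`). -/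
structure IsPolynomialChoice (β c q t : ℝ) (a j : ℕ → ℕ) (ν : Measure ℕ) : Prop where
  a_mono : Monotone a
  a_equiv : Asymptotics.IsEquivalent atTop (fun i : ℕ => (a i : ℝ))
    (fun i : ℕ => q * β / c * Real.log i)
  j_mono : Monotone j
  j_pos : 1 ≤ j 0
  j_eq : ∀ i : ℕ, 1 ≤ i → |(j i : ℝ) - (i : ℝ) ^ q| < 1
  prob : IsProbabilityMeasure ν
  tail : ∃ b : ℝ, 0 < b ∧ ∀ i : ℕ, 1 ≤ i → ν.real (Set.Ici i) = b * (i : ℝ) ^ (-t)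

end

/-! Two facts carry the theorem: the expectations of the `Δ_i` telescope, and coupling makes their
second moments small.

Unbiasedness. Averaged over its inputs, a coupled step of either chain is the same Markov operator
`transition` as a plain step (`IsAcceptBound.integral_coupledStepTop`,
`IsAcceptBound.integral_coupledStepBottom`). Hence `E Δ_i` is the difference of the expectations of
`f` after `a_i` steps in dimension `j_i` and after `a_{i-1}` steps in dimension `j_{i-1}`. The sum
telescopes to the limit of these expectations. That limit is the posterior mean: the sampler forgets
its start at rate `1 - α⋆` in every dimension, and the level posteriors converge.

Variance. Call the chains coupled when bottom = `Π_j` top, with `j = j_{i-1}`. With probability at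
least `α⋆` a step couples them; a coupled pair separates only if `U₂` falls between two acceptance
thresholds, which has probability `δ ≲ j^{-β}`. So the probability `p_n` of being uncoupled
satisfies `p_{n+1} ≤ (1 - α⋆) p_n + δ`, whence `p_n ≤ (1 - α⋆)^n + δ/α⋆`. Since `|Δ_i| ≲ j^{-κ/2}`
on coupled pairs, `E Δ_i² ≲ j^{-κ} + (1 - α⋆)^{a_{i-1}} + j^{-β}`, which for the polynomial choice
is `O(i^{-A})` for every `A < rq`.

By Minkowski's inequality `Z` is in `L²` once `∑ (E Δ_i² / P(N ≥ i))^{1/2}` converges, which needs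
`A > t + 2`. The expected cost is a sum of terms `O(i^{θq - t + ε})`, which needs `t > 1 + θq`. Both
hold for some `t` exactly when `q(r - θ) > 3`. -/

noncomputable section

/-! ### Bounded measurable functions -/

/-- Bounded measurable real functions. -/
structure BoundedMeasurable {α : Type*} [MeasurableSpace α] (g : α → ℝ) : Prop where
  measurable : Measurable g
  bound : ∃ M : ℝ, ∀ x, |g x| ≤ M

namespace BoundedMeasurable

variable {α γ : Type*} [MeasurableSpace α] [MeasurableSpace γ]

lemma integrable {g : α → ℝ} (hg : BoundedMeasurable g) (μ : Measure α) [IsFiniteMeasure μ] :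
    Integrable g μ := by
  obtain ⟨M, hM⟩ := hg.bound
  exact Integrable.of_bound hg.measurable.aestronglyMeasurable M (ae_of_all _ hM)

lemma comp {g : α → ℝ} (hg : BoundedMeasurable g) {φ : γ → α} (hφ : Measurable φ) :
    BoundedMeasurable fun c => g (φ c) :=
  ⟨hg.measurable.comp hφ, hg.bound.imp fun _ hM c => hM (φ c)⟩

lemma const (c : ℝ) : BoundedMeasurable fun _ : α => c :=
  ⟨measurable_const, |c|, fun _ => le_rfl⟩

lemma add {g h : α → ℝ} (hg : BoundedMeasurable g) (hh : BoundedMeasurable h) :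
    BoundedMeasurable fun x => g x + h x := by
  obtain ⟨M, hM⟩ := hg.bound
  obtain ⟨K, hK⟩ := hh.bound
  exact ⟨hg.measurable.add hh.measurable, M + K,
    fun x => (abs_add_le _ _).trans (add_le_add (hM x) (hK x))⟩

lemma mul {g h : α → ℝ} (hg : BoundedMeasurable g) (hh : BoundedMeasurable h) :
    BoundedMeasurable fun x => g x * h x := by
  obtain ⟨M, hM⟩ := hg.bound
  obtain ⟨K, hK⟩ := hh.bound
  refine ⟨hg.measurable.mul hh.measurable, M * K, fun x => ?_⟩
  rw [abs_mul]
  exact mul_le_mul (hM x) (hK x) (abs_nonneg _) ((abs_nonneg _).trans (hM x))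

lemma sub {g h : α → ℝ} (hg : BoundedMeasurable g) (hh : BoundedMeasurable h) :
    BoundedMeasurable fun x => g x - h x := by
  simpa [sub_eq_add_neg] using hg.add ((const (-1)).mul hh)

lemma indicator_one {s : Set α} (hs : MeasurableSet s) :
    BoundedMeasurable (s.indicator fun _ => (1 : ℝ)) := by
  refine ⟨measurable_const.indicator hs, 1, fun x => ?_⟩
  by_cases hx : x ∈ s <;> simp [hx]

lemma integral_right {g : α × γ → ℝ} (hg : BoundedMeasurable g) (μ : Measure γ)
    [IsProbabilityMeasure μ] : BoundedMeasurable fun x => ∫ c, g (x, c) ∂μ := by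
  obtain ⟨M, hM⟩ := hg.bound
  refine ⟨hg.measurable.stronglyMeasurable.integral_prod_right'.measurable, M, fun x => ?_⟩
  simpa using norm_integral_le_of_norm_le_const (μ := μ) (f := fun c => g (x, c)) (C := M)
    (ae_of_all _ fun c => hM (x, c))

end BoundedMeasurable

/-! ### Independence of coordinates in infinite products -/

section Update

variable {ι : Type*} {E : ι → Type*} [∀ i, MeasurableSpace (E i)]
  (ρ : ∀ i, Measure (E i)) [∀ i, IsProbabilityMeasure (ρ i)]

/-- Resampling one coordinate of a product measure. -/
lemma measurePreserving_update_infinitePi [DecidableEq ι] (p : ι) :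
    MeasurePreserving (fun z : (∀ i, E i) × E p => Function.update z.1 p z.2)
      ((Measure.infinitePi ρ).prod (ρ p)) (Measure.infinitePi ρ) := by
  have hm : Measurable fun z : (∀ i, E i) × E p => Function.update z.1 p z.2 := by
    fun_prop
  refine ⟨hm, Measure.eq_infinitePi ρ fun s t ht => ?_⟩
  rw [Measure.map_apply hm (MeasurableSet.pi s.countable_toSet fun i _ => ht i)]
  by_cases hp : p ∈ s
  · have : (fun z : (∀ i, E i) × E p => Function.update z.1 p z.2) ⁻¹' Set.pi s t
        = Set.pi (s.erase p : Finset ι) t ×ˢ t p := by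
      ext z
      simp only [Set.mem_preimage, Set.mem_pi, Set.mem_prod, Finset.coe_erase, Set.mem_sdiff,
        Set.mem_singleton_iff]
      constructor
      · refine fun h => ⟨fun i hi => ?_, by simpa using h p hp⟩
        simpa [hi.2] using h i hi.1
      · rintro ⟨h, h'⟩ i hi
        obtain rfl | hip := eq_or_ne i p
        · simpa using h'
        · simpa [hip] using h i ⟨hi, hip⟩
    rw [this, Measure.prod_prod, Measure.infinitePi_pi _ fun i _ => ht i,
      Finset.prod_erase_mul _ _ hp]
  · have : (fun z : (∀ i, E i) × E p => Function.update z.1 p z.2) ⁻¹' Set.pi s t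
        = Set.pi s t ×ˢ Set.univ := by
      ext z
      simp only [Set.mem_preimage, Set.mem_pi, Set.mem_prod, Set.mem_univ, and_true]
      refine forall₂_congr fun i hi => ?_
      have hip : i ≠ p := fun h => hp (h ▸ hi)
      simp [hip]
    rw [this, Measure.prod_prod, Measure.infinitePi_pi _ fun i _ => ht i, measure_univ, mul_one]

/-- A coordinate of a product measure is independent of every function of the others. -/
lemma integral_infinitePi_of_dependsOn {S : Type*} [MeasurableSpace S] {F : (∀ i, E i) → S}
    (hF : Measurable F) {p : ι} {s : Set ι} (hFs : DependsOn F s) (hp : p ∉ s)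
    {g : S × E p → ℝ} (hg : BoundedMeasurable g) :
    ∫ ω, g (F ω, ω p) ∂Measure.infinitePi ρ
      = ∫ ω, ∫ v, g (F ω, v) ∂ρ p ∂Measure.infinitePi ρ := by
  classical
  have hmp := measurePreserving_update_infinitePi ρ p
  have hgF : BoundedMeasurable fun ω : ∀ i, E i => g (F ω, ω p) :=
    hg.comp (hF.prodMk (measurable_pi_apply p))
  -- Resample coordinate `p`: the law is unchanged, and so is `F`, which does not look at `p`.
  rw [← hmp.map_eq, integral_map hmp.measurable.aemeasurable
    hgF.measurable.aestronglyMeasurable, hmp.map_eq]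
  have : ∀ z : (∀ i, E i) × E p,
      g (F (Function.update z.1 p z.2), Function.update z.1 p z.2 p) = g (F z.1, z.2) := by
    intro z
    have h : F (Function.update z.1 p z.2) = F z.1 := hFs fun i hi =>
      Function.update_of_ne (fun h : i = p => hp (h ▸ hi)) _ _
    rw [Function.update_self, h]
  simp_rw [this]
  exact integral_prod _ ((hg.comp ((hF.comp measurable_fst).prodMk measurable_snd)).integrable _)

end Update

/-! ### Threshold decisions with a uniform variable -/

section UnitInterval

lemma volume_real_unitInterval_le {a : ℝ} (h0 : 0 ≤ a) (h1 : a ≤ 1) :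
    (volume : Measure unitInterval).real {u | (u : ℝ) ≤ a} = a := by
  have := unitInterval.volume_Iic ⟨a, h0, h1⟩
  rw [Measure.real, show {u : unitInterval | (u : ℝ) ≤ a} = Set.Iic ⟨a, h0, h1⟩ from rfl, this,
    ENNReal.toReal_ofReal h0]

lemma measurableSet_unitInterval_le (a : ℝ) : MeasurableSet {u : unitInterval | (u : ℝ) ≤ a} :=
  measurableSet_le measurable_subtype_coe measurable_const

open Classical in
lemma integral_unitInterval_ite {a : ℝ} (h0 : 0 ≤ a) (h1 : a ≤ 1) (b c : ℝ) :
    ∫ u : unitInterval, (if (u : ℝ) ≤ a then b else c) = a * b + (1 - a) * c := by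
  have h : ∀ u : unitInterval, (if (u : ℝ) ≤ a then b else c)
      = {u : unitInterval | (u : ℝ) ≤ a}.indicator (fun _ => (1 : ℝ)) u * (b - c) + c := by
    intro u
    by_cases hu : (u : ℝ) ≤ a <;> simp [hu]
  simp_rw [h]
  rw [integral_add, integral_mul_const,
    integral_indicator_const _ (measurableSet_unitInterval_le a), volume_real_unitInterval_le h0 h1]
  · simp; ring
  · exact ((BoundedMeasurable.indicator_one (measurableSet_unitInterval_le a)).mul
      (.const _)).integrable _
  · exact integrable_const _

/-- The two comparisons disagree only for `u` between `a` and `b`. This bounds the chance that a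
shared uniform variable yields different accept decisions in two dimensions. -/
lemma volume_real_unitInterval_between (a b : ℝ) :
    (volume : Measure unitInterval).real {u | ¬((u : ℝ) ≤ a ↔ (u : ℝ) ≤ b)} ≤ |a - b| := by
  have hsub : (Subtype.val '' {u : unitInterval | ¬((u : ℝ) ≤ a ↔ (u : ℝ) ≤ b)})
      ⊆ Set.uIoc a b := by
    rintro _ ⟨u, hu, rfl⟩
    rw [Set.mem_ofPred_eq] at hu
    rw [Set.mem_uIoc]
    by_cases h : (u : ℝ) ≤ a
    · exact Or.inr ⟨not_le.1 fun h' => hu ⟨fun _ => h', fun _ => h⟩, h⟩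
    · refine Or.inl ⟨not_le.1 h, ?_⟩
      by_contra h'
      exact hu ⟨fun h2 => absurd h2 h, fun h2 => absurd h2 h'⟩
  rw [Measure.real, unitInterval.volume_apply]
  refine (ENNReal.toReal_mono ?_ (measure_mono hsub)).trans ?_
  · rw [Real.volume_uIoc]; exact ENNReal.ofReal_ne_top
  · rw [Real.volume_uIoc, ENNReal.toReal_ofReal (abs_nonneg _), abs_sub_comm]

end UnitInterval

/-! ### Randomly truncated series -/

section RandomizedSum

variable {Ω : Type*} (D : ℕ → Ω → ℝ)

/-- The `i`-th summand of the randomly truncated series. -/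
def truncatedTerm (i : ℕ) (ω : Ω × ℕ) : ℝ := D i ω.1 * (Set.Ici i).indicator (fun _ => (1 : ℝ)) ω.2

variable {D}

lemma tendsto_sum_truncatedTerm (ω : Ω × ℕ) :
    Tendsto (fun n => ∑ i ∈ Finset.range n, truncatedTerm D i ω) atTop
      (𝓝 (∑ i ∈ Finset.range (ω.2 + 1), D i ω.1)) := by
  refine tendsto_atTop_of_eventually_const (i₀ := ω.2 + 1) fun n hn => ?_
  rw [← Finset.sum_subset (Finset.range_mono hn)]
  · refine Finset.sum_congr rfl fun i hi => ?_
    have : i ≤ ω.2 := Nat.lt_succ_iff.1 (Finset.mem_range.1 hi)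
    simp [truncatedTerm, this]
  · intro i _ hi
    have : ¬ i ≤ ω.2 := fun h => hi (Finset.mem_range.2 (Nat.lt_succ_of_le h))
    simp [truncatedTerm, this]

variable [MeasurableSpace Ω]

/-- A locally finite series whose norms in `L^p` are summable lies in `L^p`. -/
lemma memLp_of_tsum_eLpNorm_ne_top {μ : Measure Ω} {p : ENNReal} (hp : 1 ≤ p)
    {F : ℕ → Ω → ℝ} (hF : ∀ i, AEStronglyMeasurable (F i) μ)
    {S : Ω → ℝ} (hS : ∀ ω, Tendsto (fun n => ∑ i ∈ Finset.range n, F i ω) atTop (𝓝 (S ω)))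
    (hsum : ∑' i, eLpNorm (F i) p μ ≠ ⊤) : MemLp S p μ := by
  have hpart : ∀ n, AEStronglyMeasurable (fun ω => ∑ i ∈ Finset.range n, F i ω) μ :=
    fun n => Finset.aestronglyMeasurable_fun_sum _ fun i _ => hF i
  refine ⟨aestronglyMeasurable_of_tendsto_ae atTop hpart (ae_of_all _ hS), ?_⟩
  -- Fatou's lemma reduces the claim to partial sums, where Minkowski's inequality applies.
  refine (Lp.eLpNorm_lim_le_liminf_eLpNorm hpart S (ae_of_all _ hS)).trans_lt ?_
  refine lt_of_le_of_lt ?_ (lt_top_iff_ne_top.2 hsum)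
  refine (liminf_le_liminf (Eventually.of_forall fun n => ?_)).trans
    (le_of_eq (liminf_const (∑' i, eLpNorm (F i) p μ)))
  have h1 : (fun ω => ∑ i ∈ Finset.range n, F i ω) = ∑ i ∈ Finset.range n, F i := by
    ext ω; simp
  rw [h1]
  exact (eLpNorm_sum_le (fun i _ => hF i) hp).trans (ENNReal.sum_le_tsum _)

lemma measurable_truncatedTerm (hD : ∀ i, Measurable (D i)) (i : ℕ) :
    Measurable (truncatedTerm D i) := by
  unfold truncatedTerm
  have h1 : Measurable ((Set.Ici i).indicator (fun _ : ℕ => (1 : ℝ))) := measurable_from_top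
  exact ((hD i).comp measurable_fst).mul (h1.comp measurable_snd)

/-- Independence of `N` produces the factor `P(N ≥ i)`, which the weights of the estimator are made
to cancel. -/
lemma integral_truncatedTerm (Q : Measure Ω) [IsProbabilityMeasure Q] (ν : Measure ℕ) [SFinite ν]
    (i : ℕ) :
    ∫ ω, truncatedTerm D i ω ∂(Q.prod ν) = (∫ ω, D i ω ∂Q) * ν.real (Set.Ici i) := by
  unfold truncatedTerm
  rw [integral_prod_mul (μ := Q) (ν := ν) (D i) ((Set.Ici i).indicator fun _ => (1 : ℝ)),
    integral_indicator_const _ (MeasurableSet.of_discrete)]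
  simp

lemma eLpNorm_two_eq_ofReal_sqrt {μ : Measure Ω} {g : Ω → ℝ} (hg : MemLp g 2 μ) :
    eLpNorm g 2 μ = ENNReal.ofReal (Real.sqrt (∫ ω, g ω ^ 2 ∂μ)) := by
  rw [hg.eLpNorm_eq_integral_rpow_norm (by norm_num) (by norm_num), Real.sqrt_eq_rpow]
  norm_num

variable (Q : Measure Ω) [IsProbabilityMeasure Q] (ν : Measure ℕ) [IsProbabilityMeasure ν]

/-- The variance of `|g|` is nonnegative. -/
lemma integral_abs_le_sqrt_integral_sq {g : Ω → ℝ} (hg : BoundedMeasurable g) :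
    ∫ ω, |g ω| ∂Q ≤ Real.sqrt (∫ ω, g ω ^ 2 ∂Q) := by
  refine Real.le_sqrt_of_sq_le ?_
  have hgi : Integrable (fun ω => |g ω|) Q := (hg.integrable Q).abs
  have hg2 : Integrable (fun ω => g ω ^ 2) Q := by
    simpa [pow_two] using (hg.mul hg).integrable Q
  set m := ∫ ω, |g ω| ∂Q
  have h : 0 ≤ ∫ ω, (|g ω| - m) ^ 2 ∂Q := integral_nonneg fun ω => sq_nonneg _
  have h2 : ∫ ω, (|g ω| - m) ^ 2 ∂Q = ∫ ω, g ω ^ 2 ∂Q - 2 * m * m + m ^ 2 := by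
    have : ∀ ω, (|g ω| - m) ^ 2 = g ω ^ 2 - 2 * m * |g ω| + m ^ 2 := by
      intro ω; rw [← sq_abs (g ω)]; ring
    simp_rw [this]
    rw [integral_add (f := fun ω => g ω ^ 2 - 2 * m * |g ω|) (hg2.sub (hgi.const_mul _))
        (integrable_const _),
      integral_sub hg2 (hgi.const_mul _), integral_const_mul]
    simp [m]
  nlinarith

/-- The randomly truncated series with summands `D i / P(N ≥ i)` is square integrable and
unbiased. -/
lemma memLp_and_integral_randomizedSum (hD : ∀ i, BoundedMeasurable (D i))
    (hν : ∀ i, 0 < ν.real (Set.Ici i))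
    (hsum : Summable fun i => Real.sqrt ((∫ ω, D i ω ^ 2 ∂Q) / ν.real (Set.Ici i))) :
    MemLp (fun ω : Ω × ℕ => ∑ i ∈ Finset.range (ω.2 + 1), D i ω.1 / ν.real (Set.Ici i)) 2
        (Q.prod ν) ∧
      HasSum (fun i => ∫ ω, D i ω ∂Q)
        (∫ ω, ∑ i ∈ Finset.range (ω.2 + 1), D i ω.1 / ν.real (Set.Ici i) ∂(Q.prod ν)) := by
  set D' : ℕ → Ω → ℝ := fun i ω => D i ω / ν.real (Set.Ici i) with hD'
  have hD'b : ∀ i, BoundedMeasurable (D' i) := fun i => by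
    simpa [hD', div_eq_mul_inv] using (hD i).mul (.const (ν.real (Set.Ici i))⁻¹)
  have hFm := measurable_truncatedTerm fun i => (hD'b i).measurable
  have hFb : ∀ i, BoundedMeasurable (truncatedTerm D' i) := fun i =>
    ((hD'b i).comp measurable_fst).mul
      ((BoundedMeasurable.indicator_one (MeasurableSet.of_discrete (s := Set.Ici i))).comp
        measurable_snd)
  -- Squaring leaves the indicator alone, so only one of the two factors `1 / P(N ≥ i)` is
  -- cancelled. The `L²` norms of the terms are thus exactly the summands of `hsum`.
  have hsq : ∀ i, ∫ ω, truncatedTerm D' i ω ^ 2 ∂(Q.prod ν)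
      = (∫ ω, D i ω ^ 2 ∂Q) / ν.real (Set.Ici i) := by
    intro i
    have h1 : ∀ ω : Ω × ℕ, truncatedTerm D' i ω ^ 2
        = truncatedTerm (fun i ω => D' i ω ^ 2) i ω := by
      intro ω
      by_cases h : i ≤ ω.2 <;> simp [truncatedTerm, h]
    simp_rw [h1]
    rw [integral_truncatedTerm]
    simp_rw [hD', div_pow]
    rw [integral_div]
    have := (hν i).ne'
    field_simp
  have hF2 : ∀ i, MemLp (truncatedTerm D' i) 2 (Q.prod ν) := fun i => by
    obtain ⟨M, hM⟩ := (hFb i).bound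
    exact MemLp.of_bound (hFm i).aestronglyMeasurable M (ae_of_all _ hM)
  constructor
  · refine memLp_of_tsum_eLpNorm_ne_top one_le_two (fun i => (hFm i).aestronglyMeasurable)
      (fun ω => tendsto_sum_truncatedTerm ω) ?_
    simp_rw [fun i => eLpNorm_two_eq_ofReal_sqrt (hF2 i), hsq]
    exact hsum.tsum_ofReal_ne_top
  -- `L¹` norms are at most `L²` norms, so the series may be integrated term by term.
  · have hnorm : Summable fun i => ∫ ω, ‖truncatedTerm D' i ω‖ ∂(Q.prod ν) := by
      refine Summable.of_nonneg_of_le (fun i => integral_nonneg fun ω => norm_nonneg _)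
        (fun i => ?_) hsum
      rw [← hsq]
      exact integral_abs_le_sqrt_integral_sq _ (hFb i)
    have h1 := hasSum_integral_of_summable_integral_norm
      (fun i => (hFb i).integrable (Q.prod ν)) hnorm
    have h2 : ∀ ω : Ω × ℕ, ∑' i, truncatedTerm D' i ω
        = ∑ i ∈ Finset.range (ω.2 + 1), D' i ω.1 := by
      intro ω
      rw [tsum_eq_sum (s := Finset.range (ω.2 + 1))]
      · refine Finset.sum_congr rfl fun i hi => ?_
        have : i ≤ ω.2 := Nat.lt_succ_iff.1 (Finset.mem_range.1 hi)
        simp [truncatedTerm, this]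
      · intro i hi
        have : ¬ i ≤ ω.2 := fun h => hi (Finset.mem_range.2 (Nat.lt_succ_of_le h))
        simp [truncatedTerm, this]
    simp_rw [h2] at h1
    have h3 : (fun i => ∫ ω, truncatedTerm D' i ω ∂(Q.prod ν)) = fun i => ∫ ω, D i ω ∂Q := by
      funext i
      rw [integral_truncatedTerm]
      simp_rw [hD']
      rw [integral_div, div_mul_cancel₀ _ (hν i).ne']
    rw [h3] at h1
    exact h1

/-- The expected value of a randomly truncated sum of nonnegative constants. -/
lemma integrable_randomizedSum_const {c : ℕ → ℝ} (hc : ∀ i, 0 ≤ c i)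
    (hsum : Summable fun i => c i * ν.real (Set.Ici i)) :
    Integrable (fun ω : Ω × ℕ => ∑ i ∈ Finset.range (ω.2 + 1), c i) (Q.prod ν) := by
  rw [← memLp_one_iff_integrable]
  have hFm := measurable_truncatedTerm (D := fun i (_ : Ω) => c i) fun i => measurable_const
  refine memLp_of_tsum_eLpNorm_ne_top le_rfl (fun i => (hFm i).aestronglyMeasurable)
    (fun ω => tendsto_sum_truncatedTerm (D := fun i (_ : Ω) => c i) ω) ?_
  have h1 : ∀ i, eLpNorm (truncatedTerm (fun i (_ : Ω) => c i) i) 1 (Q.prod ν)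
      = ENNReal.ofReal (c i * ν.real (Set.Ici i)) := by
    intro i
    have h0 : ∀ ω, 0 ≤ truncatedTerm (fun i (_ : Ω) => c i) i ω := fun ω =>
      mul_nonneg (hc i) (Set.indicator_nonneg (fun _ _ => zero_le_one) _)
    have hint : Integrable (truncatedTerm (fun i (_ : Ω) => c i) i) (Q.prod ν) :=
      (((BoundedMeasurable.const (c i)).comp measurable_fst).mul
        ((BoundedMeasurable.indicator_one (MeasurableSet.of_discrete (s := Set.Ici i))).comp
          measurable_snd)).integrable _
    rw [eLpNorm_one_eq_lintegral_enorm, ← ofReal_integral_norm_eq_lintegral_enorm hint]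
    simp_rw [Real.norm_of_nonneg (h0 _)]
    rw [integral_truncatedTerm]
    simp
  simp_rw [h1]
  exact hsum.tsum_ofReal_ne_top

end RandomizedSum

/-! ### Integrals over one accept-reject move -/

section Move

variable {S Y : Type*} [MeasurableSpace S] [MeasurableSpace Y]

open Classical in
lemma measurable_move {ρ : Y → ℝ} (hρ : Measurable ρ)
    {ξ x : Y → S} (hξ : Measurable ξ) (hx : Measurable x) {u : Y → unitInterval}
    (hu : Measurable u) : Measurable fun y => if (u y : ℝ) ≤ ρ y then ξ y else x y :=
  Measurable.ite (measurableSet_le (measurable_subtype_coe.comp hu) hρ) hξ hx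

open Classical in
lemma measurable_move_const {ρ : S → ℝ} (hρ : Measurable ρ) (x : S) :
    Measurable fun z : unitInterval × S => if (z.1 : ℝ) ≤ ρ z.2 then z.2 else x :=
  measurable_move (ρ := fun z : unitInterval × S => ρ z.2) (hρ.comp measurable_snd)
    measurable_snd measurable_const measurable_fst

open Classical in
lemma integral_move {μ : Measure S} [IsProbabilityMeasure μ] {ρ : S → ℝ} (hρ : Measurable ρ)
    (h0 : ∀ ξ, 0 ≤ ρ ξ) (h1 : ∀ ξ, ρ ξ ≤ 1) {g : S → ℝ} (hg : BoundedMeasurable g) (x : S) :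
    ∫ z : unitInterval × S, g (if (z.1 : ℝ) ≤ ρ z.2 then z.2 else x) ∂volume.prod μ
      = ∫ ξ, (ρ ξ * g ξ + (1 - ρ ξ) * g x) ∂μ := by
  rw [integral_prod_symm _ ((hg.comp (measurable_move_const hρ x)).integrable _)]
  refine integral_congr_ae (ae_of_all _ fun ξ => ?_)
  simp only [apply_ite g]
  exact integral_unitInterval_ite (h0 ξ) (h1 ξ) _ _

open Classical in
lemma integral_first_move {μ : Measure S} [IsProbabilityMeasure μ] {ρ : S → ℝ}
    (hρ : Measurable ρ) (h0 : ∀ ξ, 0 ≤ ρ ξ) (h1 : ∀ ξ, ρ ξ ≤ 1) {g : S → ℝ}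
    (hg : BoundedMeasurable g) (x : S) :
    ∫ w : unitInterval × unitInterval × S × S,
        g (if (w.1 : ℝ) ≤ ρ w.2.2.1 then w.2.2.1 else x) ∂volume.prod (volume.prod (μ.prod μ))
      = ∫ ξ, (ρ ξ * g ξ + (1 - ρ ξ) * g x) ∂μ := by
  have hφ : Measurable fun w : unitInterval × unitInterval × S × S => (w.1, w.2.2.1) := by
    fun_prop
  have hmv := hg.comp (measurable_move_const hρ x)
  rw [← integral_move hρ h0 h1 hg, integral_prod _ (hmv.integrable _),
    integral_prod _ ((hmv.comp hφ).integrable _)]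
  refine integral_congr_ae (ae_of_all _ fun u => ?_)
  simp only
  rw [integral_fun_snd (ν := μ.prod μ) (fun z : S × S => g (if (u : ℝ) ≤ ρ z.1 then z.1 else x)),
    integral_fun_fst (fun ξ => g (if (u : ℝ) ≤ ρ ξ then ξ else x))]
  simp

open Classical in
lemma integral_second_move {μ : Measure S} [IsProbabilityMeasure μ] {ρ : S → ℝ}
    (hρ : Measurable ρ) (h0 : ∀ ξ, 0 ≤ ρ ξ) (h1 : ∀ ξ, ρ ξ ≤ 1) {g : S → ℝ}
    (hg : BoundedMeasurable g) (x : S) :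
    ∫ v : unitInterval × S × S,
        g (if (v.1 : ℝ) ≤ ρ v.2.2 then v.2.2 else x) ∂volume.prod (μ.prod μ)
      = ∫ ξ, (ρ ξ * g ξ + (1 - ρ ξ) * g x) ∂μ := by
  have hφ : Measurable fun v : unitInterval × S × S => (v.1, v.2.2) := by fun_prop
  have hmv := hg.comp (measurable_move_const hρ x)
  rw [← integral_move hρ h0 h1 hg, integral_prod _ (hmv.integrable _),
    integral_prod _ ((hmv.comp hφ).integrable _)]
  refine integral_congr_ae (ae_of_all _ fun u => ?_)
  simp only
  rw [integral_fun_snd (fun ξ => g (if (u : ℝ) ≤ ρ ξ then ξ else x))]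
  simp

open Classical in
/-- One step that moves to a fresh proposal with probability `α` and otherwise makes an ordinary
accept-reject move. -/
lemma integral_split_move {μ : Measure S} [IsProbabilityMeasure μ] {α : ℝ} (hα0 : 0 ≤ α)
    (hα1 : α ≤ 1) {ρ : S → ℝ} (hρ : Measurable ρ) (h0 : ∀ ξ, 0 ≤ ρ ξ) (h1 : ∀ ξ, ρ ξ ≤ 1)
    {g : S → ℝ} (hg : BoundedMeasurable g) (x : S)
    (hm : Measurable fun w : unitInterval × unitInterval × S × S => if (w.1 : ℝ) ≤ α then w.2.2.1
      else if (w.2.1 : ℝ) ≤ ρ w.2.2.2 then w.2.2.2 else x) :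
    ∫ w : unitInterval × unitInterval × S × S, g (if (w.1 : ℝ) ≤ α then w.2.2.1
        else if (w.2.1 : ℝ) ≤ ρ w.2.2.2 then w.2.2.2 else x) ∂volume.prod (volume.prod (μ.prod μ))
      = α * ∫ ξ, g ξ ∂μ + (1 - α) * ∫ ξ, (ρ ξ * g ξ + (1 - ρ ξ) * g x) ∂μ := by
  rw [integral_prod _ ((hg.comp hm).integrable _), ← integral_unitInterval_ite hα0 hα1]
  refine integral_congr_ae (ae_of_all _ fun u => ?_)
  by_cases hu : (u : ℝ) ≤ α
  · simp only [hu, if_true]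
    rw [integral_fun_snd (ν := μ.prod μ) (fun z : S × S => g z.1), integral_fun_fst g]
    simp
  · simp only [hu, if_false]
    exact integral_second_move hρ h0 h1 hg x

end Move

/-! ### Acceptance probabilities: lower bound and dependence on the dimension -/

namespace InverseProblem

variable {d : ℕ} (P : InverseProblem d)

section Accept

lemma accept_nonneg (j : ℕ) (x ξ : P.X) : 0 ≤ P.accept j x ξ :=
  le_min zero_le_one (Real.exp_pos _).le

lemma accept_le_one (j : ℕ) (x ξ : P.X) : P.accept j x ξ ≤ 1 := min_le_left _ _

lemma measurable_misfit (j : ℕ) : Measurable fun x : P.X => (1 / 2) * ‖P.y - P.Gj j x‖ ^ 2 :=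
  (((P.Gj_measurable j).const_sub P.y).norm.pow_const 2).const_mul _

lemma measurable_accept (j : ℕ) : Measurable fun z : P.X × P.X => P.accept j z.1 z.2 :=
  measurable_const.min (Real.measurable_exp.comp
    (((P.measurable_misfit j).comp measurable_fst).sub
      ((P.measurable_misfit j).comp measurable_snd)))

lemma measurable_accept_comp {Y : Type*} [MeasurableSpace Y] (j : ℕ) {x ξ : Y → P.X}
    (hx : Measurable x) (hξ : Measurable ξ) : Measurable fun y => P.accept j (x y) (ξ y) := by
  have h : Measurable fun y => (x y, ξ y) := hx.prodMk hξ
  have h' := (P.measurable_accept j).comp h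
  exact h'

lemma boundedMeasurable_accept_right (j : ℕ) (x : P.X) :
    BoundedMeasurable fun ξ => P.accept j x ξ :=
  ⟨P.measurable_accept_comp j measurable_const measurable_id, 1, fun ξ => by
    rw [abs_of_nonneg (P.accept_nonneg _ _ _)]; exact P.accept_le_one _ _ _⟩

lemma boundedMeasurable_accept (j : ℕ) :
    BoundedMeasurable fun z : P.X × P.X => P.accept j z.1 z.2 :=
  ⟨P.measurable_accept j, 1, fun z => by
    rw [abs_of_nonneg (P.accept_nonneg _ _ _)]; exact P.accept_le_one _ _ _⟩

lemma Gj_proj {j j' : ℕ} (h : j ≤ j') (x : P.X) : P.Gj j (P.proj j' x) = P.Gj j x :=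
  P.Gj_dep j _ _ fun k hk => by simp [proj, hk.trans_le h]

/-- `G_j` sees only the first `j` coordinates. Hence, in a coupled pair, the bottom chain accepts
with the probability that dimension `j` assigns to the unprojected top state and proposal. -/
lemma accept_proj {j j' : ℕ} (h : j ≤ j') (x ξ : P.X) :
    P.accept j (P.proj j' x) (P.proj j' ξ) = P.accept j x ξ := by
  simp [accept, P.Gj_proj h]

lemma proj_proj {j j' : ℕ} (h : j ≤ j') (x : P.X) : P.proj j (P.proj j' x) = P.proj j x := by
  funext k
  by_cases hk : k < j
  · simp [proj, hk, hk.trans_le h]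
  · simp [proj, hk]

variable {P} {β : ℝ}

lemma ForwardRate.exists_bound (hβ : 0 ≤ β) (hG : P.ForwardRate β) :
    ∃ B : ℝ, 0 ≤ B ∧ ∀ j, 1 ≤ j → ∀ u, ‖P.y - P.Gj j u‖ ≤ B := by
  obtain ⟨⟨C, hC⟩, M, hM⟩ := hG
  refine ⟨‖P.y‖ + |M| + |C|, by positivity, fun j hj u => ?_⟩
  have h1 : ‖P.y - P.Gj j u‖ ≤ ‖P.y‖ + ‖P.G u‖ + ‖P.Gj j u - P.G u‖ := by
    have e : P.y - P.Gj j u = P.y - P.G u - (P.Gj j u - P.G u) := by abel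
    rw [e]
    exact (norm_sub_le _ _).trans (add_le_add (norm_sub_le _ _) le_rfl)
  have h2 : C * (j : ℝ) ^ (-β) ≤ |C| := by
    have h3 : (j : ℝ) ^ (-β) ≤ 1 :=
      Real.rpow_le_one_of_one_le_of_nonpos (by exact_mod_cast hj) (by linarith)
    calc C * (j : ℝ) ^ (-β) ≤ |C| * (j : ℝ) ^ (-β) :=
          mul_le_mul_of_nonneg_right (le_abs_self C) (by positivity)
      _ ≤ |C| := mul_le_of_le_one_right (abs_nonneg C) h3
  have := hC j hj u
  have := hM u
  have := le_abs_self M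
  linarith

lemma ForwardRate.exists_isAcceptBound (hβ : 0 ≤ β) (hG : P.ForwardRate β) :
    ∃ αs : ℝ, P.IsAcceptBound αs := by
  obtain ⟨B, hB0, hB⟩ := hG.exists_bound hβ
  have hle : Real.exp (-(1 / 2) * B ^ 2) ≤ 1 := Real.exp_le_one_iff.2 (by nlinarith)
  have hpos := Real.exp_pos (-(1 / 2) * B ^ 2)
  -- `exp(-B²/2)` is already a lower bound; halving it keeps it below `1` even when `B = 0`.
  refine ⟨Real.exp (-(1 / 2) * B ^ 2) / 2, by linarith, by linarith, fun j hj x ξ => ?_⟩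
  refine le_min (by linarith) ?_
  refine (half_le_self hpos.le).trans (Real.exp_le_exp.2 ?_)
  have h1 : ‖P.y - P.Gj j ξ‖ ^ 2 ≤ B ^ 2 := pow_le_pow_left₀ (norm_nonneg _) (hB j hj ξ) 2
  have h2 := sq_nonneg ‖P.y - P.Gj j x‖
  linarith

/-- The function `1 ∧ exp` is 1-Lipschitz, so differences of misfits control differences of
acceptance probabilities. -/
lemma abs_min_one_exp_sub_le (a b : ℝ) :
    |min 1 (Real.exp a) - min 1 (Real.exp b)| ≤ |a - b| := by
  wlog h : b ≤ a generalizing a b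
  · rw [abs_sub_comm, abs_sub_comm a]
    exact this b a (le_of_not_ge h)
  have hmono : min 1 (Real.exp b) ≤ min 1 (Real.exp a) :=
    min_le_min le_rfl (Real.exp_le_exp.2 h)
  rw [abs_of_nonneg (by linarith), abs_of_nonneg (by linarith)]
  rcases le_total 0 b with hb | hb
  · rw [min_eq_left (Real.one_le_exp hb), min_eq_left (Real.one_le_exp (hb.trans h))]
    linarith
  · rw [min_eq_right (Real.exp_le_one_iff.2 hb)]
    -- With `m = min 1 (exp a)`, the bound `exp (b - a) ≥ 1 + (b - a)` gives `m - exp b ≤ m (a - b)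
    -- ≤ a - b`.
    have h1 : min 1 (Real.exp a) * Real.exp (b - a) ≤ Real.exp b := by
      calc _ ≤ Real.exp a * Real.exp (b - a) :=
            mul_le_mul_of_nonneg_right (min_le_right _ _) (Real.exp_pos _).le
        _ = Real.exp b := by rw [← Real.exp_add]; congr 1; ring
    have h2 : 1 + (b - a) ≤ Real.exp (b - a) := by
      have := Real.add_one_le_exp (b - a); linarith
    have h3 : min 1 (Real.exp a) ≤ 1 := min_le_left _ _
    have h4 : 0 ≤ min 1 (Real.exp a) := le_min zero_le_one (Real.exp_pos _).le
    nlinarith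

/-- The log acceptance ratio is a difference of two misfits. Each changes by `O(j^{-β})` between the
dimensions: factor the difference of squares, with one factor bounded and the other controlled by
the distances to `G`. -/
lemma ForwardRate.exists_accept_sub_le (hβ : 0 ≤ β) (hG : P.ForwardRate β) :
    ∃ C : ℝ, 0 ≤ C ∧ ∀ j j', 1 ≤ j → j ≤ j' → ∀ x ξ,
      |P.accept j' x ξ - P.accept j x ξ| ≤ C * (j : ℝ) ^ (-β) := by
  obtain ⟨B, hB0, hB⟩ := hG.exists_bound hβ
  obtain ⟨⟨C, hC⟩, -⟩ := hG
  have hmis : ∀ j j', 1 ≤ j → j ≤ j' → ∀ x, |(1 / 2) * ‖P.y - P.Gj j' x‖ ^ 2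
      - (1 / 2) * ‖P.y - P.Gj j x‖ ^ 2| ≤ B * (2 * |C| * (j : ℝ) ^ (-β)) := by
    intro j j' hj hjj x
    have hj' : 1 ≤ j' := hj.trans hjj
    have h1 : |‖P.y - P.Gj j' x‖ - ‖P.y - P.Gj j x‖| ≤ 2 * |C| * (j : ℝ) ^ (-β) := by
      have e : P.y - P.Gj j' x - (P.y - P.Gj j x)
          = (P.Gj j x - P.G x) - (P.Gj j' x - P.G x) := by abel
      have h2 : (j' : ℝ) ^ (-β) ≤ (j : ℝ) ^ (-β) :=
        Real.rpow_le_rpow_of_nonpos (by exact_mod_cast hj) (by exact_mod_cast hjj) (by linarith)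
      have h3 : ∀ i : ℕ, 1 ≤ i → ‖P.Gj i x - P.G x‖ ≤ |C| * (i : ℝ) ^ (-β) := fun i hi =>
        (hC i hi x).trans (mul_le_mul_of_nonneg_right (le_abs_self C) (by positivity))
      have h4 : |C| * (j' : ℝ) ^ (-β) ≤ |C| * (j : ℝ) ^ (-β) :=
        mul_le_mul_of_nonneg_left h2 (abs_nonneg C)
      refine (abs_norm_sub_norm_le _ _).trans ?_
      rw [e]
      refine (norm_sub_le _ _).trans ?_
      linarith [h3 j hj, h3 j' hj']
    have h5 : (1 / 2) * ‖P.y - P.Gj j' x‖ ^ 2 - (1 / 2) * ‖P.y - P.Gj j x‖ ^ 2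
        = ((‖P.y - P.Gj j' x‖ + ‖P.y - P.Gj j x‖) / 2)
          * (‖P.y - P.Gj j' x‖ - ‖P.y - P.Gj j x‖) := by ring
    rw [h5, abs_mul, abs_of_nonneg (by positivity)]
    refine mul_le_mul ?_ h1 (abs_nonneg _) hB0
    linarith [hB j hj x, hB j' hj' x]
  refine ⟨4 * B * |C|, by positivity, fun j j' hj hjj x ξ => ?_⟩
  refine (abs_min_one_exp_sub_le _ _).trans ?_
  have e : ((1 / 2) * ‖P.y - P.Gj j' x‖ ^ 2 - (1 / 2) * ‖P.y - P.Gj j' ξ‖ ^ 2)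
      - ((1 / 2) * ‖P.y - P.Gj j x‖ ^ 2 - (1 / 2) * ‖P.y - P.Gj j ξ‖ ^ 2)
      = ((1 / 2) * ‖P.y - P.Gj j' x‖ ^ 2 - (1 / 2) * ‖P.y - P.Gj j x‖ ^ 2)
      - ((1 / 2) * ‖P.y - P.Gj j' ξ‖ ^ 2 - (1 / 2) * ‖P.y - P.Gj j ξ‖ ^ 2) := by ring
  rw [e]
  refine (abs_sub _ _).trans ?_
  linarith [hmis j j' hj hjj x, hmis j j' hj hjj ξ]

lemma ForwardRate.tendsto_Gj (hβ : 0 < β) (hG : P.ForwardRate β) (u : P.X) :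
    Tendsto (fun j => P.Gj j u) atTop (𝓝 (P.G u)) := by
  obtain ⟨⟨C, hC⟩, -⟩ := hG
  rw [tendsto_iff_norm_sub_tendsto_zero]
  have h : Tendsto (fun j : ℕ => C * (j : ℝ) ^ (-β)) atTop (𝓝 0) := by
    simpa using ((tendsto_rpow_neg_atTop hβ).comp tendsto_natCast_atTop_atTop).const_mul C
  refine squeeze_zero' (Eventually.of_forall fun j => norm_nonneg _) ?_ h
  filter_upwards [eventually_ge_atTop 1] with j hj using hC j hj u

/-- Measurability of `G` is not part of the setting; it is inherited from the `G_j` in the limit. -/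
lemma ForwardRate.measurable_G (hβ : 0 < β) (hG : P.ForwardRate β) : Measurable P.G :=
  measurable_of_tendsto_metrizable P.Gj_measurable (tendsto_pi_nhds.2 (hG.tendsto_Gj hβ))

end Accept

/-! ### The Markov operator of one step -/

section Steps

/-- The Markov operator of the independence sampler in dimension `j`. -/
def transition (j : ℕ) (g : P.X → ℝ) (x : P.X) : ℝ :=
  ∫ ξ, (P.accept j x ξ * g ξ + (1 - P.accept j x ξ) * g x) ∂P.projPrior j

variable {P}

lemma boundedMeasurable_transition (j : ℕ) {g : P.X → ℝ} (hg : BoundedMeasurable g) :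
    BoundedMeasurable (P.transition j g) :=
  BoundedMeasurable.integral_right
    (((P.boundedMeasurable_accept j).mul (hg.comp measurable_snd)).add
      (((BoundedMeasurable.const 1).sub (P.boundedMeasurable_accept j)).mul
        (hg.comp measurable_fst))) _

lemma boundedMeasurable_transition_iterate (j : ℕ) {g : P.X → ℝ} (hg : BoundedMeasurable g)
    (n : ℕ) : BoundedMeasurable ((P.transition j)^[n] g) := by
  induction n generalizing g with
  | zero => exact hg
  | succ n ih => exact ih (boundedMeasurable_transition j hg)

lemma measurable_plainStep (j : ℕ) :
    Measurable fun z : P.X × P.Seed => P.plainStep j z.1 z.2 := by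
  have hξ : Measurable fun z : P.X × P.Seed => z.2.2.2.1 :=
    measurable_fst.comp (measurable_snd.comp (measurable_snd.comp measurable_snd))
  have hα : Measurable fun z : P.X × P.Seed => P.accept j z.1 z.2.2.2.1 :=
    P.measurable_accept_comp j measurable_fst hξ
  exact measurable_move hα hξ measurable_fst (measurable_fst.comp measurable_snd)

lemma measurable_coupledStepTop (αs : ℝ) (j : ℕ) :
    Measurable fun z : P.X × P.Seed => P.coupledStepTop αs j z.1 z.2 := by
  have hξ₁ : Measurable fun z : P.X × P.Seed => z.2.2.2.1 :=
    measurable_fst.comp (measurable_snd.comp (measurable_snd.comp measurable_snd))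
  have hξ₂ : Measurable fun z : P.X × P.Seed => z.2.2.2.2 :=
    measurable_snd.comp (measurable_snd.comp (measurable_snd.comp measurable_snd))
  have hα : Measurable fun z : P.X × P.Seed => (P.accept j z.1 z.2.2.2.2 - αs) / (1 - αs) :=
    ((P.measurable_accept_comp j measurable_fst hξ₂).sub_const _).div_const _
  exact measurable_move (ρ := fun z : P.X × P.Seed => αs) measurable_const hξ₁
    (measurable_move hα hξ₂ measurable_fst
      (measurable_fst.comp (measurable_snd.comp measurable_snd)))
    (measurable_fst.comp measurable_snd)

lemma measurable_coupledStepTop_right (αs : ℝ) (j : ℕ) (x : P.X) :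
    Measurable fun w : P.Seed => P.coupledStepTop αs j x w := by
  have h : Measurable fun w : P.Seed => (x, w) := measurable_prodMk_left
  have h' := (measurable_coupledStepTop αs j).comp h
  exact h'

/-- Projection of the two proposals of a step. -/
def projSeed (j : ℕ) (w : P.Seed) : P.Seed := (w.1, w.2.1, P.proj j w.2.2.1, P.proj j w.2.2.2)

lemma measurable_projSeed (j : ℕ) : Measurable (projSeed (P := P) j) := by
  have := P.measurable_proj j
  unfold projSeed
  fun_prop

lemma measurable_coupledStepBottom (αs : ℝ) (j : ℕ) :
    Measurable fun z : P.X × P.Seed => P.coupledStepBottom αs j z.1 z.2 :=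
  (measurable_coupledStepTop αs j).comp
    (measurable_fst.prodMk ((measurable_projSeed j).comp measurable_snd))

lemma measurePreserving_proj {j j' : ℕ} (h : j ≤ j') :
    MeasurePreserving (P.proj j) (P.projPrior j') (P.projPrior j) := by
  refine ⟨P.measurable_proj j, ?_⟩
  rw [projPrior, projPrior, Measure.map_map (P.measurable_proj j) (P.measurable_proj j')]
  congr 1
  funext x
  exact P.proj_proj h x

lemma measurePreserving_projSeed {j j' : ℕ} (h : j ≤ j') :
    MeasurePreserving (projSeed (P := P) j) (P.seedLaw j') (P.seedLaw j) :=
  (MeasurePreserving.id _).prod ((MeasurePreserving.id _).prod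
    ((measurePreserving_proj h).prod (measurePreserving_proj h)))

lemma integral_plainStep (j : ℕ) {g : P.X → ℝ} (hg : BoundedMeasurable g) (x : P.X) :
    ∫ w, g (P.plainStep j x w) ∂P.seedLaw j = P.transition j g x :=
  integral_first_move (P.boundedMeasurable_accept_right j x).measurable (P.accept_nonneg j x)
    (P.accept_le_one j x) hg x

variable {αs : ℝ}

/-- A proposal is accepted with total probability `α⋆ + (1 - α⋆) (α_j - α⋆) / (1 - α⋆) = α_j`, and
`ξ₁`, `ξ₂` have the same law. Splitting the step therefore does not change the kernel. -/
lemma IsAcceptBound.integral_coupledStepTop (h : P.IsAcceptBound αs) {j : ℕ} (hj : 1 ≤ j)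
    {g : P.X → ℝ} (hg : BoundedMeasurable g) (x : P.X) :
    ∫ w, g (P.coupledStepTop αs j x w) ∂P.seedLaw j = P.transition j g x := by
  obtain ⟨hα0, hα1, hα⟩ := h
  have hα1' : 0 < 1 - αs := by linarith
  set ρ : P.X → ℝ := fun ξ => (P.accept j x ξ - αs) / (1 - αs) with hρ
  have hacc := P.boundedMeasurable_accept_right j x
  have hρm : Measurable ρ := (hacc.measurable.sub_const _).div_const _
  have hρ0 : ∀ ξ, 0 ≤ ρ ξ := fun ξ => div_nonneg (sub_nonneg.2 (hα j hj x ξ)) hα1'.le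
  have hρ1 : ∀ ξ, ρ ξ ≤ 1 := fun ξ =>
    (div_le_one hα1').2 (sub_le_sub_right (P.accept_le_one j x ξ) _)
  have hρb : BoundedMeasurable ρ := ⟨hρm, 1, fun ξ => by rw [abs_of_nonneg (hρ0 ξ)]; exact hρ1 ξ⟩
  have hm := measurable_coupledStepTop_right (P := P) αs j x
  have hb := (hρb.mul hg).add (((BoundedMeasurable.const 1).sub hρb).mul (.const (g x)))
  refine (integral_split_move hα0.le hα1.le hρm hρ0 hρ1 hg x hm).trans ?_
  rw [transition, ← integral_const_mul, ← integral_const_mul,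
    ← integral_add ((hg.integrable _).const_mul _) ((hb.integrable _).const_mul _)]
  refine integral_congr_ae (ae_of_all _ fun ξ => ?_)
  simp only [hρ]
  field_simp
  ring

/-- Projecting seeds of dimension `j'` gives seeds of dimension `j`, because `Π_j Π_{j'} = Π_j`. -/
lemma IsAcceptBound.integral_coupledStepBottom (h : P.IsAcceptBound αs) {j j' : ℕ} (hj : 1 ≤ j)
    (hjj : j ≤ j') {g : P.X → ℝ} (hg : BoundedMeasurable g) (x : P.X) :
    ∫ w, g (P.coupledStepBottom αs j x w) ∂P.seedLaw j' = P.transition j g x := by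
  have hmp := measurePreserving_projSeed (P := P) hjj
  have hgm : Measurable fun w => g (P.coupledStepTop αs j x w) :=
    hg.measurable.comp (measurable_coupledStepTop_right αs j x)
  rw [← h.integral_coupledStepTop hj hg x, ← hmp.map_eq, integral_map hmp.measurable.aemeasurable
    hgm.aestronglyMeasurable]
  rfl

end Steps


/-! ### Level posteriors: invariance and geometric ergodicity -/

/-- The unnormalized posterior density in dimension `j`. -/
def weight (j : ℕ) (x : P.X) : ℝ := Real.exp (-(1 / 2) * ‖P.y - P.Gj j x‖ ^ 2)

/-- The posterior in dimension `j`. -/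
def levelPosterior (j : ℕ) : Measure P.X :=
  (P.projPrior j).tilted fun u => -(1 / 2) * ‖P.y - P.Gj j u‖ ^ 2

lemma exp_neg_half_sq_le_one (a : ℝ) : Real.exp (-(1 / 2) * a ^ 2) ≤ 1 :=
  Real.exp_le_one_iff.2 (by nlinarith [sq_nonneg a])

lemma weight_pos (j : ℕ) (x : P.X) : 0 < P.weight j x := Real.exp_pos _

lemma weight_le_one (j : ℕ) (x : P.X) : P.weight j x ≤ 1 := exp_neg_half_sq_le_one _

lemma boundedMeasurable_weight (j : ℕ) : BoundedMeasurable (P.weight j) := by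
  refine ⟨?_, 1, fun x => ?_⟩
  · exact Real.measurable_exp.comp
      ((((P.Gj_measurable j).const_sub P.y).norm.pow_const 2).const_mul (-(1 / 2)))
  · rw [abs_of_pos (P.weight_pos j x)]
    exact P.weight_le_one j x

/-- Detailed balance: the right-hand side is symmetric in `x` and `ξ`. -/
lemma weight_mul_accept (j : ℕ) (x ξ : P.X) :
    P.weight j x * P.accept j x ξ = min (P.weight j x) (P.weight j ξ) := by
  rw [accept, mul_min_of_nonneg _ _ (P.weight_pos j x).le, mul_one, weight, weight, ← Real.exp_add]
  congr 2
  ring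

variable {P}

/-- By detailed balance the two sides differ by the double integral of `min (w x) (w ξ) * (g ξ - g
x)`. This is antisymmetric, so swapping the variables shows that it equals its own negative. -/
lemma integral_weight_mul_transition (j : ℕ) {g : P.X → ℝ} (hg : BoundedMeasurable g) :
    ∫ x, P.weight j x * P.transition j g x ∂P.projPrior j
      = ∫ x, P.weight j x * g x ∂P.projPrior j := by
  set μ := P.projPrior j
  have hw := P.boundedMeasurable_weight j
  have hk : BoundedMeasurable fun z : P.X × P.X =>
      min (P.weight j z.1) (P.weight j z.2) * (g z.2 - g z.1) := by
    have h1 : BoundedMeasurable fun z : P.X × P.X => min (P.weight j z.1) (P.weight j z.2) := by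
      refine ⟨(hw.comp measurable_fst).measurable.min (hw.comp measurable_snd).measurable, 1,
        fun z => ?_⟩
      rw [abs_of_pos (lt_min (P.weight_pos j _) (P.weight_pos j _))]
      exact (min_le_left _ _).trans (P.weight_le_one j _)
    exact h1.mul ((hg.comp measurable_snd).sub (hg.comp measurable_fst))
  have h0 : ∫ x, ∫ ξ, min (P.weight j x) (P.weight j ξ) * (g ξ - g x) ∂μ ∂μ = 0 := by
    have h1 := integral_integral_swap (μ := μ) (ν := μ)
      (f := fun x ξ => min (P.weight j x) (P.weight j ξ) * (g ξ - g x)) (hk.integrable _)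
    have h2 : ∀ x, ∫ ξ, min (P.weight j ξ) (P.weight j x) * (g x - g ξ) ∂μ
        = -∫ ξ, min (P.weight j x) (P.weight j ξ) * (g ξ - g x) ∂μ := by
      intro x
      rw [← integral_neg]
      refine integral_congr_ae (ae_of_all _ fun ξ => ?_)
      simp only
      rw [min_comm]
      ring
    simp_rw [h2] at h1
    rw [integral_neg] at h1
    linarith
  have h3 : ∀ x, P.weight j x * P.transition j g x
      = P.weight j x * g x + ∫ ξ, min (P.weight j x) (P.weight j ξ) * (g ξ - g x) ∂μ := by
    intro x
    have hα := P.boundedMeasurable_accept_right j x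
    have h4 : P.transition j g x = ∫ ξ, (g x + P.accept j x ξ * (g ξ - g x)) ∂μ := by
      refine integral_congr_ae (ae_of_all _ fun ξ => ?_)
      simp only
      ring
    rw [h4, integral_add (integrable_const _) ((hα.mul (hg.sub (.const (g x)))).integrable _),
      mul_add]
    simp_rw [← weight_mul_accept, mul_assoc]
    rw [integral_const_mul]
    simp
  simp_rw [h3]
  rw [integral_add ((hw.mul hg).integrable _) ((hk.integral_right μ).integrable _), h0, add_zero]

lemma integral_levelPosterior (j : ℕ) (g : P.X → ℝ) :
    ∫ x, g x ∂P.levelPosterior j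
      = (∫ x, P.weight j x * g x ∂P.projPrior j) / ∫ x, P.weight j x ∂P.projPrior j := by
  rw [levelPosterior, integral_tilted, ← integral_div]
  refine integral_congr_ae (ae_of_all _ fun x => ?_)
  simp only [weight, smul_eq_mul]
  ring

instance (j : ℕ) : IsProbabilityMeasure (P.levelPosterior j) :=
  isProbabilityMeasure_tilted ((P.boundedMeasurable_weight j).integrable _)

/-- The level posterior is invariant under the independence sampler. -/
lemma integral_transition_iterate_levelPosterior (j n : ℕ) {g : P.X → ℝ}
    (hg : BoundedMeasurable g) :
    ∫ x, (P.transition j)^[n] g x ∂P.levelPosterior j = ∫ x, g x ∂P.levelPosterior j := by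
  induction n generalizing g with
  | zero => rfl
  | succ n ih =>
    rw [Function.iterate_succ_apply, ih (boundedMeasurable_transition j hg),
      integral_levelPosterior, integral_weight_mul_transition j hg, ← integral_levelPosterior]

open Classical in
lemma integral_seedLaw_ite {αs : ℝ} (h0 : 0 ≤ αs) (h1 : αs ≤ 1) (j : ℕ) (b c : ℝ) :
    ∫ w : P.Seed, (if (w.1 : ℝ) ≤ αs then b else c) ∂P.seedLaw j = αs * b + (1 - αs) * c := by
  rw [seedLaw, integral_fun_fst (fun u : unitInterval => if (u : ℝ) ≤ αs then b else c),
    integral_unitInterval_ite h0 h1]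
  simp

open Classical in
lemma boundedMeasurable_ite_seed (αs : ℝ) (b c : ℝ) :
    BoundedMeasurable fun w : P.Seed => if (w.1 : ℝ) ≤ αs then b else c := by
  refine ⟨Measurable.ite ((measurableSet_unitInterval_le αs).preimage measurable_fst)
    measurable_const measurable_const, max |b| |c|, fun w => ?_⟩
  split_ifs
  exacts [le_max_left _ _, le_max_right _ _]

variable {αs : ℝ}

/-- Run two chains with the same seed: for `U₁ ≤ α⋆` both land at `ξ₁` and the difference vanishes;
otherwise it is at most the oscillation `K`. -/
lemma IsAcceptBound.abs_transition_sub_le (h : P.IsAcceptBound αs) {j : ℕ} (hj : 1 ≤ j)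
    {g : P.X → ℝ} (hg : BoundedMeasurable g) {K : ℝ} (hK : ∀ x x', |g x - g x'| ≤ K)
    (x x' : P.X) : |P.transition j g x - P.transition j g x'| ≤ (1 - αs) * K := by
  classical
  have hb : ∀ x, BoundedMeasurable fun w => g (P.coupledStepTop αs j x w) := fun x =>
    hg.comp (measurable_coupledStepTop_right αs j x)
  rw [← h.integral_coupledStepTop hj hg, ← h.integral_coupledStepTop hj hg,
    ← integral_sub ((hb x).integrable _) ((hb x').integrable _)]
  have hi := integral_seedLaw_ite (P := P) h.1.le h.2.1.le j 0 K
  rw [mul_zero, zero_add] at hi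
  rw [← hi]
  refine abs_integral_le_integral_abs.trans (integral_mono
    (((hb x).sub (hb x')).integrable _).abs ((boundedMeasurable_ite_seed αs 0 K).integrable _)
    fun w => ?_)
  by_cases hw : (w.1 : ℝ) ≤ αs
  · simp [coupledStepTop, hw]
  · simp only [hw, if_false]
    exact hK _ _

lemma IsAcceptBound.abs_transition_iterate_sub_le (h : P.IsAcceptBound αs) {j : ℕ} (hj : 1 ≤ j)
    {g : P.X → ℝ} (hg : BoundedMeasurable g) {K : ℝ} (hK : ∀ x x', |g x - g x'| ≤ K) (n : ℕ)
    (x x' : P.X) :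
    |(P.transition j)^[n] g x - (P.transition j)^[n] g x'| ≤ (1 - αs) ^ n * K := by
  induction n generalizing g K with
  | zero => simpa using hK x x'
  | succ n ih =>
    rw [Function.iterate_succ_apply, pow_succ, mul_assoc]
    exact ih (boundedMeasurable_transition j hg) (h.abs_transition_sub_le hj hg hK)

/-- Uniform geometric ergodicity of the independence sampler. -/
lemma IsAcceptBound.abs_transition_iterate_sub_integral_le (h : P.IsAcceptBound αs) {j : ℕ}
    (hj : 1 ≤ j) {g : P.X → ℝ} (hg : BoundedMeasurable g) {K : ℝ}
    (hK : ∀ x x', |g x - g x'| ≤ K) (n : ℕ) (x : P.X) :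
    |(P.transition j)^[n] g x - ∫ x', g x' ∂P.levelPosterior j| ≤ (1 - αs) ^ n * K := by
  have hb := boundedMeasurable_transition_iterate j hg n
  rw [← integral_transition_iterate_levelPosterior j n hg]
  -- Averaging the contraction over `x'` drawn from the invariant law compares with a stationary
  -- chain.
  have e : (P.transition j)^[n] g x - ∫ x', (P.transition j)^[n] g x' ∂P.levelPosterior j
      = ∫ x', ((P.transition j)^[n] g x - (P.transition j)^[n] g x') ∂P.levelPosterior j := by
    rw [integral_sub (integrable_const _) (hb.integrable _)]
    simp
  rw [e]
  simpa using norm_integral_le_of_norm_le_const (μ := P.levelPosterior j)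
    (f := fun x' => (P.transition j)^[n] g x - (P.transition j)^[n] g x')
    (ae_of_all _ fun x' => h.abs_transition_iterate_sub_le hj hg hK n x x')

/-! ### Convergence to the posterior -/

section Limit

variable {β : ℝ}

lemma ForwardRate.boundedMeasurable_density (hβ : 0 < β) (hG : P.ForwardRate β) :
    BoundedMeasurable fun u : P.X => Real.exp (-(1 / 2) * ‖P.y - P.G u‖ ^ 2) := by
  refine ⟨?_, 1, fun x => ?_⟩
  · exact Real.measurable_exp.comp
      ((((hG.measurable_G hβ).const_sub P.y).norm.pow_const 2).const_mul (-(1 / 2)))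
  · rw [abs_of_pos (Real.exp_pos _)]
    exact exp_neg_half_sq_le_one _

lemma ForwardRate.isProbabilityMeasure_posterior (hβ : 0 < β) (hG : P.ForwardRate β) :
    IsProbabilityMeasure P.posterior :=
  isProbabilityMeasure_tilted ((hG.boundedMeasurable_density hβ).integrable _)

lemma ForwardRate.tendsto_integral_weight_mul (hβ : 0 < β) (hG : P.ForwardRate β) {f : P.X → ℝ}
    (hf : BoundedMeasurable f)
    (hlim : ∀ x, Tendsto (fun j => f (P.proj j x)) atTop (𝓝 (f x))) :
    Tendsto (fun j => ∫ x, P.weight j x * f x ∂P.projPrior j) atTop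
      (𝓝 (∫ x, Real.exp (-(1 / 2) * ‖P.y - P.G x‖ ^ 2) * f x ∂P.prior)) := by
  obtain ⟨M, hM⟩ := hf.bound
  have h1 : ∀ j, ∫ x, P.weight j x * f x ∂P.projPrior j
      = ∫ x, P.weight j x * f (P.proj j x) ∂P.prior := by
    intro j
    rw [projPrior, integral_map (P.measurable_proj j).aemeasurable
      ((P.boundedMeasurable_weight j).mul hf).measurable.aestronglyMeasurable]
    refine integral_congr_ae (ae_of_all _ fun x => ?_)
    simp only [weight, P.Gj_proj le_rfl]
  simp_rw [h1]
  refine tendsto_integral_of_dominated_convergence (fun _ => M)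
    (fun j => ((P.boundedMeasurable_weight j).mul
      (hf.comp (P.measurable_proj j))).measurable.aestronglyMeasurable)
    (integrable_const _) (fun j => ae_of_all _ fun x => ?_) (ae_of_all _ fun x => ?_)
  · rw [norm_mul, Real.norm_eq_abs, Real.norm_eq_abs, abs_of_pos (P.weight_pos j x)]
    exact (mul_le_of_le_one_left (abs_nonneg _) (P.weight_le_one j x)).trans (hM _)
  · refine Tendsto.mul ?_ (hlim x)
    exact (Real.continuous_exp.tendsto _).comp
      ((((tendsto_const_nhds.sub (hG.tendsto_Gj hβ x)).norm).pow 2).const_mul _)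

lemma ForwardRate.tendsto_integral_levelPosterior (hβ : 0 < β) (hG : P.ForwardRate β)
    {f : P.X → ℝ} (hf : BoundedMeasurable f)
    (hlim : ∀ x, Tendsto (fun j => f (P.proj j x)) atTop (𝓝 (f x))) :
    Tendsto (fun j => ∫ x, f x ∂P.levelPosterior j) atTop (𝓝 (∫ x, f x ∂P.posterior)) := by
  have h1 := hG.tendsto_integral_weight_mul hβ hf hlim
  -- The case `f = 1` gives convergence of the normalizing constants.
  have h2 := hG.tendsto_integral_weight_mul hβ (f := fun _ => 1) (.const 1)
    fun _ => tendsto_const_nhds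
  simp only [mul_one] at h2
  have hpos : 0 < ∫ x, Real.exp (-(1 / 2) * ‖P.y - P.G x‖ ^ 2) ∂P.prior :=
    integral_exp_pos ((hG.boundedMeasurable_density hβ).integrable _)
  have h3 : ∫ x, f x ∂P.posterior
      = (∫ x, Real.exp (-(1 / 2) * ‖P.y - P.G x‖ ^ 2) * f x ∂P.prior)
        / ∫ x, Real.exp (-(1 / 2) * ‖P.y - P.G x‖ ^ 2) ∂P.prior := by
    rw [posterior, integral_tilted, ← integral_div]
    refine integral_congr_ae (ae_of_all _ fun x => ?_)
    simp only [smul_eq_mul]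
    ring
  simp_rw [integral_levelPosterior]
  rw [h3]
  exact h1.div h2 hpos.ne'

/-- The law of the chain after `a i` steps in dimension `j i` converges to the posterior. -/
lemma IsAcceptBound.tendsto_transition_iterate (h : P.IsAcceptBound αs) (hβ : 0 < β)
    (hG : P.ForwardRate β) {f : P.X → ℝ} (hf : BoundedMeasurable f)
    (hlim : ∀ x, Tendsto (fun j => f (P.proj j x)) atTop (𝓝 (f x))) {a j : ℕ → ℕ}
    (ha : Tendsto a atTop atTop) (hj : Tendsto j atTop atTop) (hj1 : ∀ i, 1 ≤ j i) (x : P.X) :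
    Tendsto (fun i => (P.transition (j i))^[a i] f x) atTop (𝓝 (∫ u, f u ∂P.posterior)) := by
  obtain ⟨M, hM⟩ := hf.bound
  have hK : ∀ x x', |f x - f x'| ≤ M + M := fun x x' =>
    (abs_sub _ _).trans (add_le_add (hM x) (hM x'))
  -- The mixing rate is the same in all dimensions, so it does not matter that `j i` grows along
  -- with `a i`.
  have h1 : Tendsto (fun i => (1 - αs) ^ a i * (M + M)) atTop (𝓝 0) := by
    have := (tendsto_pow_atTop_nhds_zero_of_lt_one (r := 1 - αs) (by linarith [h.2.1])
      (by linarith [h.1])).comp ha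
    simpa using this.mul_const (M + M)
  have h2 : Tendsto (fun i => (P.transition (j i))^[a i] f x
      - ∫ x', f x' ∂P.levelPosterior (j i)) atTop (𝓝 0) :=
    squeeze_zero_norm (fun i =>
      h.abs_transition_iterate_sub_integral_le (hj1 i) hf hK (a i) x) h1
  simpa using h2.add ((hG.tendsto_integral_levelPosterior hβ hf hlim).comp hj)

end Limit

/-! ### Chains driven by independent inputs -/

variable (P)

/-- The law of all inputs of the algorithm. -/
def inputLaw (j : ℕ → ℕ) : Measure (ℕ × ℕ → P.Seed) :=
  Measure.infinitePi fun p : ℕ × ℕ => P.seedLaw (j p.1)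

instance (j : ℕ → ℕ) : IsProbabilityMeasure (P.inputLaw j) := by
  unfold inputLaw; infer_instance

variable {P}

section Chain

variable {step : P.X → P.Seed → P.X} {F : (ℕ × ℕ → P.Seed) → P.X}

lemma measurable_chain (hstep : Measurable fun z : P.X × P.Seed => step z.1 z.2)
    (hF : Measurable F) (i b n : ℕ) :
    Measurable fun ω : ℕ × ℕ → P.Seed => P.chain step (fun m => ω (i, b + m)) (F ω) n := by
  induction n with
  | zero => exact hF
  | succ n ih =>
    have h1 : Measurable fun ω : ℕ × ℕ → P.Seed =>
        (P.chain step (fun m => ω (i, b + m)) (F ω) n, ω (i, b + n)) :=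
      ih.prodMk (measurable_pi_apply _)
    have h2 := hstep.comp h1
    exact h2

/-- This is what makes the current state independent of the next input `ω (i, b + n)`, as the Markov
property requires. -/
lemma dependsOn_chain {b : ℕ} (hF : DependsOn F {p : ℕ × ℕ | p.2 < b}) (i n : ℕ) :
    DependsOn (fun ω : ℕ × ℕ → P.Seed => P.chain step (fun m => ω (i, b + m)) (F ω) n)
      {p : ℕ × ℕ | p.2 < b + n} := by
  induction n with
  | zero => exact hF
  | succ n ih =>
    intro ω ω' h
    have h1 : P.chain step (fun m => ω (i, b + m)) (F ω) n
        = P.chain step (fun m => ω' (i, b + m)) (F ω') n :=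
      ih fun p hp => h p (lt_trans hp (Nat.lt_succ_self _))
    have h2 : ω (i, b + n) = ω' (i, b + n) := h (i, b + n) (Nat.lt_succ_self _)
    simp only [chain, h1, h2]

/-- The Markov property of a chain driven by independent inputs. -/
lemma integral_chain (hstep : Measurable fun z : P.X × P.Seed => step z.1 z.2)
    (hF : Measurable F) {b : ℕ} (hFb : DependsOn F {p : ℕ × ℕ | p.2 < b}) {j : ℕ → ℕ} {i : ℕ}
    {T : (P.X → ℝ) → P.X → ℝ} (hTb : ∀ g, BoundedMeasurable g → BoundedMeasurable (T g))
    (hT : ∀ g, BoundedMeasurable g → ∀ x, ∫ v, g (step x v) ∂P.seedLaw (j i) = T g x)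
    (n : ℕ) {g : P.X → ℝ} (hg : BoundedMeasurable g) :
    ∫ ω, g (P.chain step (fun m => ω (i, b + m)) (F ω) n) ∂P.inputLaw j
      = ∫ ω, T^[n] g (F ω) ∂P.inputLaw j := by
  induction n generalizing g with
  | zero => rfl
  | succ n ih =>
    have h1 : BoundedMeasurable fun z : P.X × P.Seed => g (step z.1 z.2) := hg.comp hstep
    have h2 := integral_infinitePi_of_dependsOn (fun p : ℕ × ℕ => P.seedLaw (j p.1))
      (measurable_chain hstep hF i b n) (dependsOn_chain hFb i n) (p := (i, b + n))
      (lt_irrefl (b + n)) h1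
    simp only [hT g hg] at h2
    rw [Function.iterate_succ_apply, ← ih (hTb g hg)]
    exact h2

end Chain

/-! ### Coupling of the top and bottom chains -/

section Coupling

variable (P) in
/-- The set of pairs of states which are not coupled. -/
def uncoupled (j : ℕ) : Set (P.X × P.X) := {z | z.2 ≠ P.proj j z.1}

lemma measurableSet_uncoupled (j : ℕ) : MeasurableSet (P.uncoupled j) :=
  (measurableSet_eq_fun measurable_snd ((P.measurable_proj j).comp measurable_fst)).compl

variable {αs : ℝ}

lemma measurable_coupledPair (αs : ℝ) (j j' : ℕ) :
    Measurable fun z : (P.X × P.X) × P.Seed =>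
      (P.coupledStepTop αs j' z.1.1 z.2, P.coupledStepBottom αs j z.1.2 z.2) := by
  have h1 : Measurable fun z : (P.X × P.X) × P.Seed => (z.1.1, z.2) :=
    (measurable_fst.comp measurable_fst).prodMk measurable_snd
  have h2 : Measurable fun z : (P.X × P.X) × P.Seed => (z.1.2, z.2) :=
    (measurable_snd.comp measurable_fst).prodMk measurable_snd
  have h3 := (measurable_coupledStepTop (P := P) αs j').comp h1
  have h4 := (measurable_coupledStepBottom (P := P) αs j).comp h2
  exact h3.prodMk h4

/-- For fixed `ξ₂` the indicator asks that `U₂` fall between two thresholds at distance at most `δ`;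
integrating over `U₂` first gives the bound. -/
lemma integral_seedLaw_le_of_between {j : ℕ} {ρ ρ' : P.X → ℝ} (hρ : Measurable ρ)
    (hρ' : Measurable ρ') {δ : ℝ} (hδ : ∀ ξ, |ρ ξ - ρ' ξ| ≤ δ) {h : P.Seed → ℝ}
    (hh : BoundedMeasurable h) (hle : ∀ w : P.Seed, h w ≤
      {v : unitInterval × P.X | ¬((v.1 : ℝ) ≤ ρ v.2 ↔ (v.1 : ℝ) ≤ ρ' v.2)}.indicator
        (fun _ => (1 : ℝ)) (w.2.1, w.2.2.2)) :
    ∫ w, h w ∂P.seedLaw j ≤ δ := by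
  set A : Set (unitInterval × P.X) := {v | ¬((v.1 : ℝ) ≤ ρ v.2 ↔ (v.1 : ℝ) ≤ ρ' v.2)}
  have hu : Measurable fun v : unitInterval × P.X => (v.1 : ℝ) :=
    measurable_subtype_coe.comp measurable_fst
  have hA : MeasurableSet A := by
    have h1 : MeasurableSet {v : unitInterval × P.X | (v.1 : ℝ) ≤ ρ v.2} :=
      measurableSet_le hu (hρ.comp measurable_snd)
    have h2 : MeasurableSet {v : unitInterval × P.X | (v.1 : ℝ) ≤ ρ' v.2} :=
      measurableSet_le hu (hρ'.comp measurable_snd)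
    have h3 := measurableSet_setOfPred.2
      ((measurableSet_setOfPred.1 h1).iff (measurableSet_setOfPred.1 h2)).not
    exact h3
  have hAb := BoundedMeasurable.indicator_one hA
  have hφ : Measurable fun v : unitInterval × P.X × P.X => (v.1, v.2.2) :=
    measurable_fst.prodMk (measurable_snd.comp measurable_snd)
  have hAb' := hAb.comp hφ
  have hφ' : Measurable fun w : P.Seed => w.2 := measurable_snd
  have hAb'' := hAb'.comp hφ'
  refine (integral_mono (hh.integrable _) (hAb''.integrable (P.seedLaw j)) hle).trans ?_
  rw [seedLaw, integral_fun_snd (ν := (volume : Measure unitInterval).prod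
      ((P.projPrior j).prod (P.projPrior j)))
      (fun v : unitInterval × P.X × P.X => A.indicator (fun _ => (1 : ℝ)) (v.1, v.2.2)),
    integral_prod_symm _ (hAb'.integrable _)]
  have hin : ∀ z : P.X × P.X, ∫ u : unitInterval, A.indicator (fun _ => (1 : ℝ)) (u, z.2) ≤ δ := by
    intro z
    have h1 : (fun u : unitInterval => A.indicator (fun _ => (1 : ℝ)) (u, z.2))
        = {u : unitInterval | ¬((u : ℝ) ≤ ρ z.2 ↔ (u : ℝ) ≤ ρ' z.2)}.indicator fun _ => 1 := rfl
    have h2 : MeasurableSet {u : unitInterval | ¬((u : ℝ) ≤ ρ z.2 ↔ (u : ℝ) ≤ ρ' z.2)} :=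
      hA.preimage measurable_prodMk_right
    rw [h1, integral_indicator_const _ h2, smul_eq_mul, mul_one]
    exact (volume_real_unitInterval_between _ _).trans (hδ _)
  have hsw : BoundedMeasurable fun q : (P.X × P.X) × unitInterval =>
      A.indicator (fun _ => (1 : ℝ)) (q.2, q.1.2) := by
    have hψ : Measurable fun q : (P.X × P.X) × unitInterval => (q.2, q.1.2) :=
      measurable_snd.prodMk (measurable_snd.comp measurable_fst)
    exact hAb.comp hψ
  refine (smul_le_of_le_one_left ?_ ?_).trans ((integral_mono
    ((hsw.integral_right volume).integrable _) (integrable_const δ) hin).trans ?_)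
  · exact integral_nonneg fun z => integral_nonneg fun u =>
      Set.indicator_nonneg (fun _ _ => zero_le_one) _
  · simp
  · simp

/-- The coupled step keeps a coupled pair coupled up to a small probability, and couples an
uncoupled pair with probability at least `αs`. -/
lemma IsAcceptBound.integral_uncoupled_step_le (h : P.IsAcceptBound αs) {j j' : ℕ} {δ : ℝ}
    (hδ0 : 0 ≤ δ) (hδ : ∀ x ξ, |P.accept j' x ξ - P.accept j x ξ| ≤ (1 - αs) * δ) (z : P.X × P.X) :
    ∫ w, (P.uncoupled j).indicator (fun _ => (1 : ℝ))
        (P.coupledStepTop αs j' z.1 w, P.coupledStepBottom αs j z.2 w) ∂P.seedLaw j'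
      ≤ (1 - αs) * (P.uncoupled j).indicator (fun _ => (1 : ℝ)) z + δ := by
  classical
  have hα1 : 0 < 1 - αs := by linarith [h.2.1]
  have hb : BoundedMeasurable fun w => (P.uncoupled j).indicator (fun _ => (1 : ℝ))
      (P.coupledStepTop αs j' z.1 w, P.coupledStepBottom αs j z.2 w) := by
    have h1 : Measurable fun w : P.Seed => (z, w) := measurable_prodMk_left
    have h2 := (measurable_coupledPair αs j j').comp h1
    exact (BoundedMeasurable.indicator_one (measurableSet_uncoupled j)).comp h2
  obtain ⟨x, y⟩ := z
  by_cases hz : (x, y) ∈ P.uncoupled j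
  · rw [Set.indicator_of_mem hz, mul_one]
    -- An uncoupled pair becomes coupled whenever `U₁ ≤ αs`: the chains move to `ξ₁` and `Π_j ξ₁`.
    have hi := integral_seedLaw_ite (P := P) h.1.le h.2.1.le j' 0 1
    rw [mul_zero, zero_add, mul_one] at hi
    refine le_trans ?_ (le_add_of_nonneg_right hδ0)
    rw [← hi]
    refine integral_mono (hb.integrable _) ((boundedMeasurable_ite_seed αs 0 1).integrable _)
      fun w => ?_
    by_cases hw : (w.1 : ℝ) ≤ αs
    · simp [coupledStepBottom, coupledStepTop, hw, uncoupled]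
    · simp only [hw, if_false]
      exact Set.indicator_le_self' (fun _ _ => zero_le_one) _
  · rw [Set.indicator_of_notMem hz, mul_zero, zero_add]
    have hy : y = P.proj j x := not_not.1 hz
    have hm : ∀ i, Measurable fun ξ => (P.accept i x ξ - αs) / (1 - αs) := fun i =>
      ((P.boundedMeasurable_accept_right i x).measurable.sub_const _).div_const _
    -- A coupled pair separates only if the two chains decide differently about `ξ₂`.
    refine integral_seedLaw_le_of_between (hm j') (hm j) (fun ξ => ?_) hb fun w => ?_
    · rw [← sub_div, sub_sub_sub_cancel_right, abs_div, abs_of_pos hα1, div_le_iff₀ hα1, mul_comm]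
      exact hδ x ξ
    · have hacc : P.accept j y (P.proj j w.2.2.2) = P.accept j x w.2.2.2 := by
        rw [hy, P.accept_proj le_rfl]
      by_cases hw : (w.1 : ℝ) ≤ αs
      · have : (P.coupledStepTop αs j' x w, P.coupledStepBottom αs j y w) ∉ P.uncoupled j := by
          simp [coupledStepBottom, coupledStepTop, hw, uncoupled]
        rw [Set.indicator_of_notMem this]
        exact Set.indicator_nonneg (fun _ _ => zero_le_one) _
      · by_cases h1 : (w.2.1 : ℝ) ≤ (P.accept j' x w.2.2.2 - αs) / (1 - αs) ↔
            (w.2.1 : ℝ) ≤ (P.accept j x w.2.2.2 - αs) / (1 - αs)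
        · have : (P.coupledStepTop αs j' x w, P.coupledStepBottom αs j y w) ∉ P.uncoupled j := by
            by_cases h2 : (w.2.1 : ℝ) ≤ (P.accept j x w.2.2.2 - αs) / (1 - αs)
            · simp [coupledStepBottom, coupledStepTop, hw, uncoupled, hacc, h2, h1.2 h2]
            · have h3 : ¬ (w.2.1 : ℝ) ≤ (P.accept j' x w.2.2.2 - αs) / (1 - αs) :=
                fun h3 => h2 (h1.1 h3)
              simp only [coupledStepBottom, coupledStepTop, hw, uncoupled, hacc, h2, h3, if_false]
              simpa using hy
          rw [Set.indicator_of_notMem this]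
          exact Set.indicator_nonneg (fun _ _ => zero_le_one) _
        · rw [Set.indicator_of_mem (s := {v : unitInterval × P.X | _}) (by exact h1)]
          exact Set.indicator_le_self' (fun _ _ => zero_le_one) _

/-- The probability of being uncoupled after `n` coupled steps. -/
lemma IsAcceptBound.integral_uncoupled_chain_le (h : P.IsAcceptBound αs) {j' : ℕ} {δ : ℝ}
    {j : ℕ → ℕ} {i : ℕ} (hδ0 : 0 ≤ δ)
    (hδ : ∀ x ξ, |P.accept (j i) x ξ - P.accept j' x ξ| ≤ (1 - αs) * δ)
    {F₁ F₂ : (ℕ × ℕ → P.Seed) → P.X} (hF₁ : Measurable F₁) (hF₂ : Measurable F₂) {b : ℕ}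
    (hF₁b : DependsOn F₁ {p : ℕ × ℕ | p.2 < b}) (hF₂b : DependsOn F₂ {p : ℕ × ℕ | p.2 < b})
    (n : ℕ) :
    ∫ ω, (P.uncoupled j').indicator (fun _ => (1 : ℝ))
        (P.chain (P.coupledStepTop αs (j i)) (fun m => ω (i, b + m)) (F₁ ω) n,
          P.chain (P.coupledStepBottom αs j') (fun m => ω (i, b + m)) (F₂ ω) n) ∂P.inputLaw j
      ≤ (1 - αs) ^ n + δ / αs := by
  have hα1 : 0 < 1 - αs := by linarith [h.2.1]
  have hind := BoundedMeasurable.indicator_one (measurableSet_uncoupled (P := P) j')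
  have hm : ∀ n, Measurable fun ω : ℕ × ℕ → P.Seed =>
      (P.chain (P.coupledStepTop αs (j i)) (fun m => ω (i, b + m)) (F₁ ω) n,
        P.chain (P.coupledStepBottom αs j') (fun m => ω (i, b + m)) (F₂ ω) n) := fun n =>
    (measurable_chain (measurable_coupledStepTop αs (j i)) hF₁ i b n).prodMk
      (measurable_chain (measurable_coupledStepBottom αs j') hF₂ i b n)
  induction n with
  | zero =>
    refine (integral_mono ((hind.comp (hm 0)).integrable _) (integrable_const (1 : ℝ))
      fun ω => Set.indicator_le_self' (fun _ _ => zero_le_one) _).trans ?_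
    simpa using div_nonneg hδ0 h.1.le
  | succ n ih =>
    have hdep : DependsOn (fun ω : ℕ × ℕ → P.Seed =>
        (P.chain (P.coupledStepTop αs (j i)) (fun m => ω (i, b + m)) (F₁ ω) n,
          P.chain (P.coupledStepBottom αs j') (fun m => ω (i, b + m)) (F₂ ω) n))
        {p : ℕ × ℕ | p.2 < b + n} := fun ω ω' hω =>
      Prod.ext (dependsOn_chain hF₁b i n hω) (dependsOn_chain hF₂b i n hω)
    have hg := hind.comp (measurable_coupledPair (P := P) αs j' (j i))
    have h2 := integral_infinitePi_of_dependsOn (fun p : ℕ × ℕ => P.seedLaw (j p.1))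
      (hm n) hdep (p := (i, b + n)) (lt_irrefl (b + n)) hg
    refine h2.le.trans ?_
    refine (integral_mono (((hg.integral_right (P.seedLaw (j i))).comp (hm n)).integrable
        (P.inputLaw j))
      ((((BoundedMeasurable.const (1 - αs)).mul (hind.comp (hm n))).add (.const δ)).integrable
        (P.inputLaw j))
      fun ω => h.integral_uncoupled_step_le hδ0 hδ _).trans ?_
    rw [integral_add (((BoundedMeasurable.const (1 - αs)).mul (hind.comp (hm n))).integrable _)
      (integrable_const _), integral_const_mul]
    have h3 := mul_le_mul_of_nonneg_left ih hα1.le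
    -- `δ / αs` is the fixed point of the one-step recursion `p ↦ (1 - αs) p + δ`.
    have h4 : (1 - αs) * (δ / αs) + δ = δ / αs := by
      have := h.1.ne'
      field_simp
      ring
    simp only [integral_const, probReal_univ, one_smul]
    rw [pow_succ]
    nlinarith

end Coupling

/-! ### Moments of the level differences -/

section Delta

variable {αs : ℝ} {a j : ℕ → ℕ} {f : P.X → ℝ}

/-- The state of the top chain after its plain steps. -/
def warmStart (P : InverseProblem d) (a j : ℕ → ℕ) (x₀ : P.X) (i : ℕ) (ω : ℕ × ℕ → P.Seed) : P.X :=
  P.chain (P.plainStep (j (i + 1))) (fun m => ω (i + 1, m)) x₀ (a (i + 1) - a i)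

lemma measurable_warmStart (x₀ : P.X) (i : ℕ) : Measurable (warmStart P a j x₀ i) := by
  have h := measurable_chain (measurable_plainStep (P := P) (j (i + 1)))
    (measurable_const (a := x₀)) (i + 1) 0 (a (i + 1) - a i)
  simp only [zero_add] at h
  exact h

lemma dependsOn_warmStart (x₀ : P.X) (i : ℕ) :
    DependsOn (warmStart P a j x₀ i) {p : ℕ × ℕ | p.2 < a (i + 1) - a i} := by
  have h := dependsOn_chain (P := P) (step := P.plainStep (j (i + 1))) (F := fun _ => x₀) (b := 0)
    (fun _ _ _ => rfl) (i + 1) (a (i + 1) - a i)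
  simp only [zero_add] at h
  exact h

/-- The final state of the top chain. -/
def finalTop (P : InverseProblem d) (αs : ℝ) (a j : ℕ → ℕ) (x₀ : P.X) (i : ℕ)
    (ω : ℕ × ℕ → P.Seed) : P.X :=
  P.chain (P.coupledStepTop αs (j (i + 1))) (fun m => ω (i + 1, a (i + 1) - a i + m))
    (warmStart P a j x₀ i ω) (a i)

/-- The final state of the bottom chain. -/
def finalBottom (P : InverseProblem d) (αs : ℝ) (a j : ℕ → ℕ) (x₀ : P.X) (i : ℕ)
    (ω : ℕ × ℕ → P.Seed) : P.X :=
  P.chain (P.coupledStepBottom αs (j i)) (fun m => ω (i + 1, a (i + 1) - a i + m)) x₀ (a i)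

lemma delta_succ (x₀ : P.X) (i : ℕ) (ω : ℕ × ℕ → P.Seed) :
    P.delta αs a j f x₀ (i + 1) (fun m => ω (i + 1, m))
      = f (finalTop P αs a j x₀ i ω) - f (finalBottom P αs a j x₀ i ω) := rfl

lemma measurable_finalTop (x₀ : P.X) (i : ℕ) : Measurable (finalTop P αs a j x₀ i) :=
  measurable_chain (measurable_coupledStepTop αs _) (measurable_warmStart x₀ i) _ _ _

lemma measurable_finalBottom (x₀ : P.X) (i : ℕ) : Measurable (finalBottom P αs a j x₀ i) :=
  measurable_chain (measurable_coupledStepBottom αs _) measurable_const _ _ _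

lemma measurable_plainChain (x₀ : P.X) (k i n : ℕ) : Measurable fun ω : ℕ × ℕ → P.Seed =>
    P.chain (P.plainStep k) (fun m => ω (i, m)) x₀ n := by
  have h := measurable_chain (measurable_plainStep (P := P) k) (measurable_const (a := x₀)) i 0 n
  simp only [zero_add] at h
  exact h

lemma boundedMeasurable_delta (hf : BoundedMeasurable f) (x₀ : P.X) (i : ℕ) :
    BoundedMeasurable fun ω : ℕ × ℕ → P.Seed => P.delta αs a j f x₀ i fun m => ω (i, m) := by
  cases i with
  | zero => exact hf.comp (measurable_plainChain x₀ (j 0) 0 (a 0))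
  | succ i =>
    simp_rw [delta_succ]
    exact (hf.comp (measurable_finalTop x₀ i)).sub (hf.comp (measurable_finalBottom x₀ i))

lemma integral_plainChain (hf : BoundedMeasurable f) (x₀ : P.X) (i n : ℕ) :
    ∫ ω, f (P.chain (P.plainStep (j i)) (fun m => ω (i, m)) x₀ n) ∂P.inputLaw j
      = (P.transition (j i))^[n] f x₀ := by
  have h := integral_chain (measurable_plainStep (P := P) (j i)) (measurable_const (a := x₀))
    (b := 0) (fun _ _ _ => rfl) (fun g hg => boundedMeasurable_transition (j i) hg)
    (fun g hg x => integral_plainStep (j i) hg x) n hf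
  simp only [zero_add] at h
  rw [h]
  simp

lemma integral_delta_zero (hf : BoundedMeasurable f) (x₀ : P.X) :
    ∫ ω, P.delta αs a j f x₀ 0 (fun m => ω (0, m)) ∂P.inputLaw j
      = (P.transition (j 0))^[a 0] f x₀ :=
  integral_plainChain hf x₀ 0 (a 0)

/-- Separately, each chain evolves by the plain Markov operator of its own dimension. The `a (i + 1)
- a i` plain and `a i` coupled steps of the top chain add up to `a (i + 1)`. -/
lemma IsAcceptBound.integral_delta_succ (h : P.IsAcceptBound αs) (ha : Monotone a)
    (hj : Monotone j) (hj1 : ∀ i, 1 ≤ j i) (hf : BoundedMeasurable f) (x₀ : P.X) (i : ℕ) :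
    ∫ ω, P.delta αs a j f x₀ (i + 1) (fun m => ω (i + 1, m)) ∂P.inputLaw j
      = (P.transition (j (i + 1)))^[a (i + 1)] f x₀ - (P.transition (j i))^[a i] f x₀ := by
  simp_rw [delta_succ]
  rw [integral_sub ((hf.comp (measurable_finalTop x₀ i)).integrable _)
    ((hf.comp (measurable_finalBottom x₀ i)).integrable _)]
  congr 1
  · have h1 := integral_chain (measurable_coupledStepTop (P := P) αs (j (i + 1)))
      (measurable_warmStart (a := a) (j := j) x₀ i) (dependsOn_warmStart x₀ i)
      (fun g hg => boundedMeasurable_transition (j (i + 1)) hg)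
      (fun g hg x => h.integral_coupledStepTop (hj1 (i + 1)) hg x) (a i) hf
    refine h1.trans ?_
    refine (integral_plainChain (boundedMeasurable_transition_iterate _ hf _) x₀ (i + 1) _).trans ?_
    rw [← Function.iterate_add_apply, Nat.sub_add_cancel (ha (Nat.le_succ i))]
  · have h1 := integral_chain (measurable_coupledStepBottom (P := P) αs (j i))
      (measurable_const (a := x₀)) (b := a (i + 1) - a i) (j := j) (i := i + 1)
      (fun _ _ _ => rfl) (fun g hg => boundedMeasurable_transition (j i) hg)
      (fun g hg x => h.integral_coupledStepBottom (hj1 i) (hj (Nat.le_succ i)) hg x) (a i) hf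
    refine h1.trans ?_
    simp

/-- On coupled final states the difference is `f t - f (Π_j t)`, at most `ε`; elsewhere it is at
most `2 * M`, weighted by the probability of being uncoupled. -/
lemma IsAcceptBound.integral_delta_sq_le (h : P.IsAcceptBound αs) {δ ε M : ℝ} (hδ0 : 0 ≤ δ)
    {i : ℕ} (hδ : ∀ x ξ, |P.accept (j (i + 1)) x ξ - P.accept (j i) x ξ| ≤ (1 - αs) * δ)
    (hfm : Measurable f) (hM : ∀ x, |f x| ≤ M) (hε : ∀ x, |f x - f (P.proj (j i) x)| ≤ ε)
    (x₀ : P.X) :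
    ∫ ω, P.delta αs a j f x₀ (i + 1) (fun m => ω (i + 1, m)) ^ 2 ∂P.inputLaw j
      ≤ ε ^ 2 + (2 * M) ^ 2 * ((1 - αs) ^ a i + δ / αs) := by
  have hf : BoundedMeasurable f := ⟨hfm, M, hM⟩
  have hind := (BoundedMeasurable.indicator_one (measurableSet_uncoupled (P := P) (j i))).comp
    ((measurable_finalTop (αs := αs) (a := a) (j := j) x₀ i).prodMk
      (measurable_finalBottom (αs := αs) (a := a) (j := j) x₀ i))
  have hΔ := boundedMeasurable_delta (αs := αs) (a := a) (j := j) hf x₀ (i + 1)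
  have h1 : ∀ ω : ℕ × ℕ → P.Seed, P.delta αs a j f x₀ (i + 1) (fun m => ω (i + 1, m)) ^ 2
      ≤ ε ^ 2 + (2 * M) ^ 2 * (P.uncoupled (j i)).indicator (fun _ => (1 : ℝ))
        (finalTop P αs a j x₀ i ω, finalBottom P αs a j x₀ i ω) := by
    intro ω
    rw [delta_succ]
    set t := finalTop P αs a j x₀ i ω
    set b := finalBottom P αs a j x₀ i ω
    by_cases hu : (t, b) ∈ P.uncoupled (j i)
    · rw [Set.indicator_of_mem hu, mul_one, ← sq_abs]
      have h2 : |f t - f b| ≤ 2 * M := by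
        have := (abs_sub (f t) (f b)).trans (add_le_add (hM t) (hM b))
        linarith
      have h3 := pow_le_pow_left₀ (abs_nonneg _) h2 2
      nlinarith [sq_nonneg ε]
    · have hb : b = P.proj (j i) t := not_not.1 hu
      rw [Set.indicator_of_notMem hu, mul_zero, add_zero, ← sq_abs, hb]
      exact pow_le_pow_left₀ (abs_nonneg _) (hε t) 2
  have hsq : Integrable (fun ω : ℕ × ℕ → P.Seed =>
      P.delta αs a j f x₀ (i + 1) (fun m => ω (i + 1, m)) ^ 2) (P.inputLaw j) := by
    simpa [pow_two] using (hΔ.mul hΔ).integrable (P.inputLaw j)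
  refine (integral_mono hsq (((BoundedMeasurable.const (ε ^ 2)).add
    ((BoundedMeasurable.const ((2 * M) ^ 2)).mul hind)).integrable _) h1).trans ?_
  rw [integral_add (integrable_const _)
    (((BoundedMeasurable.const ((2 * M) ^ 2)).mul hind).integrable _), integral_const_mul]
  simp only [integral_const, probReal_univ, one_smul]
  refine add_le_add le_rfl (mul_le_mul_of_nonneg_left ?_ (sq_nonneg _))
  exact h.integral_uncoupled_chain_le hδ0 hδ (measurable_warmStart x₀ i) measurable_const
    (dependsOn_warmStart x₀ i) (fun _ _ _ => rfl) (a i)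

/-- Unbiasedness and finite variance, given summability of the second moments. -/
lemma IsAcceptBound.works (h : P.IsAcceptBound αs) {β : ℝ} (hβ : 0 < β) (hG : P.ForwardRate β)
    (hf : BoundedMeasurable f)
    (hlim : ∀ x, Tendsto (fun j => f (P.proj j x)) atTop (𝓝 (f x)))
    {ν : Measure ℕ} (hc : IsParameterChoice a j ν) {s : ℕ → NNReal}
    (hcost : Summable fun i => levelCost s a j i * ν.real (Set.Ici i))
    (hvar : ∀ x₀, Summable fun i => Real.sqrt
      ((∫ ω, P.delta αs a j f x₀ i (fun m => ω (i, m)) ^ 2 ∂P.inputLaw j) / ν.real (Set.Ici i))) :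
    P.Works αs s f a j ν := by
  have := hc.prob
  have hj1 : ∀ i, 1 ≤ j i := fun i => hc.j_pos.trans (hc.j_mono (Nat.zero_le i))
  intro x₀ _
  have hD := fun i => boundedMeasurable_delta (αs := αs) (a := a) (j := j) hf x₀ i
  obtain ⟨hL2, hsum⟩ := memLp_and_integral_randomizedSum (P.inputLaw j) ν hD hc.tail_pos (hvar x₀)
  refine ⟨hL2, ?_, ?_⟩
  · have htel : ∀ n, ∑ i ∈ Finset.range (n + 1),
        ∫ ω, P.delta αs a j f x₀ i (fun m => ω (i, m)) ∂P.inputLaw j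
        = (P.transition (j n))^[a n] f x₀ := by
      intro n
      induction n with
      | zero => rw [Finset.sum_range_one]; exact integral_delta_zero hf x₀
      | succ n ih =>
        rw [Finset.sum_range_succ, ih, h.integral_delta_succ hc.a_mono hc.j_mono hj1 hf]
        ring
    have h1 := (tendsto_add_atTop_iff_nat 1).2 hsum.tendsto_sum_nat
    simp_rw [htel] at h1
    exact tendsto_nhds_unique h1
      (h.tendsto_transition_iterate hβ hG hf hlim hc.a_lim hc.j_lim hj1 x₀)
  · refine integrable_randomizedSum_const (P.inputLaw j) ν (fun i => ?_) hcost
    cases i <;> simp only [levelCost] <;> positivity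

end Delta

end InverseProblem

/-! ### Summability for the polynomial choice -/

section Asymptotics

open Asymptotics

/-- Absorbs both the rounding of `j_i` and the shift from `i` to `i + 1`, for exponents of either
sign. -/
lemma rpow_le_two_rpow_abs_mul {x y : ℝ} (hx : 0 < x) (h1 : x / 2 ≤ y) (h2 : y ≤ 2 * x) (e : ℝ) :
    y ^ e ≤ 2 ^ |e| * x ^ e := by
  have hy : 0 < y := (half_pos hx).trans_le h1
  rcases le_total 0 e with he | he
  · rw [abs_of_nonneg he, ← Real.mul_rpow zero_le_two hx.le]
    exact Real.rpow_le_rpow hy.le h2 he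
  · have h3 : (2 : ℝ) ^ (-e) * x ^ e = (x / 2) ^ e := by
      rw [Real.div_rpow hx.le zero_le_two, Real.rpow_neg zero_le_two]
      ring
    rw [abs_of_nonpos he, h3]
    exact Real.rpow_le_rpow_of_nonpos (half_pos hx) h1 he

lemma isBigO_natCast_rpow {x y : ℝ} (h : x ≤ y) :
    (fun i : ℕ => (i : ℝ) ^ x) =O[atTop] fun i : ℕ => (i : ℝ) ^ y := by
  refine IsBigO.of_bound 1 ?_
  filter_upwards [eventually_ge_atTop 1] with i hi
  rw [Real.norm_of_nonneg (by positivity), Real.norm_of_nonneg (by positivity), one_mul]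
  exact Real.rpow_le_rpow_of_exponent_le (by exact_mod_cast hi) h

lemma isBigO_natCast_succ_rpow (e : ℝ) :
    (fun i : ℕ => ((i + 1 : ℕ) : ℝ) ^ e) =O[atTop] fun i : ℕ => (i : ℝ) ^ e := by
  refine IsBigO.of_bound (2 ^ |e|) ?_
  filter_upwards [eventually_ge_atTop 1] with i hi
  have h1 : (1 : ℝ) ≤ i := by exact_mod_cast hi
  rw [Real.norm_of_nonneg (by positivity), Real.norm_of_nonneg (by positivity)]
  refine rpow_le_two_rpow_abs_mul (by linarith) ?_ ?_ e <;> push_cast <;> linarith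

lemma isBigO_natCast_mul_rpow {u v : ℕ → ℝ} {x y : ℝ} (hu : u =O[atTop] fun i : ℕ => (i : ℝ) ^ x)
    (hv : v =O[atTop] fun i : ℕ => (i : ℝ) ^ y) :
    (fun i => u i * v i) =O[atTop] fun i : ℕ => (i : ℝ) ^ (x + y) := by
  refine (hu.mul hv).congr' EventuallyEq.rfl ?_
  filter_upwards [eventually_ge_atTop 1] with i hi
  rw [Real.rpow_add (by exact_mod_cast hi)]

end Asymptotics

namespace IsPolynomialChoice

open Asymptotics

variable {β c q t : ℝ} {a j : ℕ → ℕ} {ν : Measure ℕ}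

lemma rpow_isBigO (h : IsPolynomialChoice β c q t a j ν) (hq : 0 < q) (e : ℝ) :
    (fun i => (j i : ℝ) ^ e) =O[atTop] fun i : ℕ => (i : ℝ) ^ (q * e) := by
  have hlim : Tendsto (fun i : ℕ => (i : ℝ) ^ q) atTop atTop :=
    (tendsto_rpow_atTop hq).comp tendsto_natCast_atTop_atTop
  refine IsBigO.of_bound (2 ^ |e|) ?_
  filter_upwards [eventually_ge_atTop 1, hlim.eventually_ge_atTop 2] with i hi h2
  have h3 := abs_lt.1 (h.j_eq i hi)
  rw [Real.norm_of_nonneg (by positivity), Real.norm_of_nonneg (by positivity),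
    Real.rpow_mul (by positivity)]
  exact rpow_le_two_rpow_abs_mul (by linarith) (by linarith) (by linarith) e

lemma tendsto_a (h : IsPolynomialChoice β c q t a j ν) (hc : 0 < q * β / c) :
    Tendsto a atTop atTop := by
  rw [← tendsto_natCast_atTop_iff (R := ℝ)]
  exact h.a_equiv.symm.tendsto_atTop
    ((Real.tendsto_log_atTop.comp tendsto_natCast_atTop_atTop).const_mul_atTop hc)

lemma isParameterChoice (h : IsPolynomialChoice β c q t a j ν) (hq : 0 < q)
    (hc : 0 < q * β / c) : IsParameterChoice a j ν := by
  have := h.prob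
  refine ⟨h.a_mono, h.tendsto_a hc, h.j_mono, ?_, h.j_pos, h.prob, fun i => ?_⟩
  · rw [← tendsto_natCast_atTop_iff (R := ℝ)]
    have hlim : Tendsto (fun i : ℕ => (i : ℝ) ^ q - 1) atTop atTop :=
      tendsto_atTop_add_const_right _ _
        ((tendsto_rpow_atTop hq).comp tendsto_natCast_atTop_atTop)
    refine tendsto_atTop_mono' _ ?_ hlim
    filter_upwards [eventually_ge_atTop 1] with i hi
    linarith [(abs_lt.1 (h.j_eq i hi)).1]
  · obtain ⟨b, hb, htail⟩ := h.tail
    rcases Nat.eq_zero_or_pos i with rfl | hi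
    · have : Set.Ici (0 : ℕ) = Set.univ := by ext; simp
      simp [this]
    · rw [htail i hi]
      have : (0 : ℝ) < i := by exact_mod_cast hi
      positivity

/-- Writing `a i = φ i * (q β / c) log i` with `φ → 1` turns the power into `i ^ (-φ i q β)`. As `φ
i` may stay below `1`, some room `A < q β` is needed. -/
lemma pow_isBigO (h : IsPolynomialChoice β c q t a j ν) (hc : 0 < c) (hqβ : 0 < q * β) {A : ℝ}
    (hA : A < q * β) :
    (fun i => Real.exp (-c) ^ a i) =O[atTop] fun i : ℕ => (i : ℝ) ^ (-A) := by
  obtain ⟨φ, hφ, heq⟩ := h.a_equiv.exists_eq_mul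
  have hlt : A / (q * β) < 1 := (div_lt_one hqβ).2 hA
  refine IsBigO.of_bound 1 ?_
  filter_upwards [eventually_ge_atTop 1, heq, hφ.eventually (lt_mem_nhds hlt)] with i hi hai hφi
  have h1 : (1 : ℝ) ≤ i := by exact_mod_cast hi
  have hlog := Real.log_nonneg h1
  rw [Real.norm_of_nonneg (by positivity), Real.norm_of_nonneg (by positivity), one_mul,
    ← Real.exp_nat_mul, Real.rpow_def_of_pos (by linarith)]
  refine Real.exp_le_exp.2 ?_
  simp only [Pi.mul_apply] at hai
  rw [div_lt_iff₀ hqβ] at hφi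
  have h2 : (a i : ℝ) * c = φ i * (q * β) * Real.log i := by
    rw [hai]; field_simp
  nlinarith

lemma a_isBigO (h : IsPolynomialChoice β c q t a j ν) {ε : ℝ} (hε : 0 < ε) :
    (fun i => (a i : ℝ)) =O[atTop] fun i : ℕ => (i : ℝ) ^ ε := by
  refine h.a_equiv.isBigO.trans ?_
  exact (((isLittleO_log_rpow_atTop hε).comp_tendsto
    tendsto_natCast_atTop_atTop).isBigO).const_mul_left _

lemma summable_cost (h : IsPolynomialChoice β c q t a j ν) (hq : 0 < q) {θ : ℝ}
    (ht : 1 + θ * q < t) {s : ℕ → NNReal}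
    (hs : ∃ C : ℝ, ∀ j : ℕ, 1 ≤ j → (s j : ℝ) ≤ C * (j : ℝ) ^ θ) :
    Summable fun i => InverseProblem.levelCost s a j i * ν.real (Set.Ici i) := by
  obtain ⟨C, hC⟩ := hs
  obtain ⟨b, hb, htail⟩ := h.tail
  rw [← summable_nat_add_iff 1]
  -- Half of the slack pays for the logarithm in `a i`; the final exponent is `-1 - ε`.
  set ε := (t - (1 + θ * q)) / 2 with hε
  have hε0 : 0 < ε := by rw [hε]; linarith
  have hsj : (fun i => (s (j i) : ℝ)) =O[atTop] fun i : ℕ => (i : ℝ) ^ (q * θ) := by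
    refine IsBigO.trans (IsBigO.of_bound C (Eventually.of_forall fun i => ?_)) (h.rpow_isBigO hq θ)
    rw [Real.norm_of_nonneg (by positivity), Real.norm_of_nonneg (by positivity)]
    exact hC _ (h.j_pos.trans (h.j_mono (Nat.zero_le i)))
  have hu := isBigO_natCast_mul_rpow (h.a_isBigO hε0) hsj
  have hu' := (hu.comp_tendsto (tendsto_add_atTop_nat 1)).trans
    (isBigO_natCast_succ_rpow (ε + q * θ))
  have hp : (fun i : ℕ => ν.real (Set.Ici (i + 1))) =O[atTop] fun i : ℕ => (i : ℝ) ^ (-t) := by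
    simp_rw [fun i : ℕ => htail (i + 1) (Nat.succ_pos i)]
    exact (isBigO_natCast_succ_rpow (-t)).const_mul_left b
  refine summable_of_isBigO_nat ?_ (isBigO_natCast_mul_rpow (hu'.add hu) hp)
  rw [Real.summable_nat_rpow, hε]
  linarith

lemma summable_sqrt_div (h : IsPolynomialChoice β c q t a j ν) {A : ℝ} (hA : t + 2 < A)
    {v : ℕ → ℝ} (hv : (fun i => v (i + 1)) =O[atTop] fun i : ℕ => (i : ℝ) ^ (-A)) :
    Summable fun i => Real.sqrt (v i / ν.real (Set.Ici i)) := by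
  obtain ⟨b, hb, htail⟩ := h.tail
  -- The tail formula holds only for `i ≥ 1`. The shifted terms are `O(i ^ ((t - A) / 2))`, summable
  -- because `t + 2 < A`.
  rw [← summable_nat_add_iff 1]
  have hp : (fun i : ℕ => (ν.real (Set.Ici (i + 1)))⁻¹) =O[atTop]
      fun i : ℕ => (i : ℝ) ^ t := by
    have : ∀ i : ℕ, (ν.real (Set.Ici (i + 1)))⁻¹ = b⁻¹ * ((i + 1 : ℕ) : ℝ) ^ t := by
      intro i
      rw [htail (i + 1) (Nat.succ_pos i), Real.rpow_neg (by positivity), mul_inv, inv_inv]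
    simp_rw [this]
    exact (isBigO_natCast_succ_rpow t).const_mul_left b⁻¹
  have h1 := (isBigO_natCast_mul_rpow hv hp).rpow (r := 1 / 2) (by norm_num)
    (Eventually.of_forall fun i => by positivity)
  refine summable_of_isBigO_nat (g := fun i : ℕ => (i : ℝ) ^ ((-A + t) * (1 / 2))) ?_ ?_
  · rw [Real.summable_nat_rpow]
    linarith
  · refine h1.congr (fun i => ?_) (fun i => ?_)
    · simp only [Real.sqrt_eq_rpow, div_eq_mul_inv]
    · rw [← Real.rpow_mul (by positivity)]

end IsPolynomialChoice

/-! ### Decay of the second moments for the polynomial choice -/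

namespace InverseProblem

open Asymptotics

variable {d : ℕ} {P : InverseProblem d}

/-- Let `j' → ∞` in the rate between two finite dimensions. -/
lemma ObservableRate.exists_abs_sub_proj_le {f : P.X → ℝ} {κ : ℝ} (hf : P.ObservableRate f κ) :
    ∃ C : ℝ, ∀ j, 1 ≤ j → ∀ x, |f x - f (P.proj j x)| ≤ C * (j : ℝ) ^ (-(κ / 2)) := by
  obtain ⟨⟨C, hC⟩, hlim⟩ := hf
  refine ⟨C, fun j hj x => le_of_tendsto ((hlim x).sub_const _).abs ?_⟩
  filter_upwards [eventually_ge_atTop j] with j' hj'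
  have h1 := hC j' j (hj.trans hj') hj x
  rwa [min_eq_right (by exact_mod_cast hj')] at h1

/-- The polynomial choice of the parameters works. -/
lemma IsAcceptBound.works_of_isPolynomialChoice {αs : ℝ} (h : P.IsAcceptBound αs)
    {f : P.X → ℝ} {s : ℕ → NNReal} {β κ θ q t : ℝ} (hβ : 0 < β)
    (hG : P.ForwardRate β) (hfb : BoundedMeasurable f) (hf : P.ObservableRate f κ)
    (hs : ∃ C : ℝ, ∀ j : ℕ, 1 ≤ j → (s j : ℝ) ≤ C * (j : ℝ) ^ θ) (hq : 0 < q)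
    (ht1 : 1 + θ * q < t) (ht2 : t < min β κ * q - 2) {a j : ℕ → ℕ} {ν : Measure ℕ}
    (hc : IsPolynomialChoice β (-Real.log (1 - αs)) q t a j ν) : P.Works αs s f a j ν := by
  have hα1 : 0 < 1 - αs := by linarith [h.2.1]
  have hcpos : 0 < -Real.log (1 - αs) :=
    neg_pos.2 (Real.log_neg hα1 (by linarith [h.1]))
  have hqβ : 0 < q * β := mul_pos hq hβ
  have hpc := hc.isParameterChoice hq (div_pos hqβ hcpos)
  refine h.works hβ hG hfb hf.2 hpc (hc.summable_cost hq ht1 hs) fun x₀ => ?_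
  -- `A` is the decay exponent to be proved for the second moments: above `t + 2` for summability,
  -- below `q β` and `q κ` so that all three error terms meet it.
  obtain ⟨A, hA1, hA2⟩ := exists_between (show t + 2 < min β κ * q by linarith)
  have hAβ : A < q * β := by
    have := mul_le_mul_of_nonneg_right (min_le_left β κ) hq.le
    linarith
  have hAκ : A < q * κ := by
    have := mul_le_mul_of_nonneg_right (min_le_right β κ) hq.le
    linarith
  obtain ⟨Cf, hCf⟩ := hf.exists_abs_sub_proj_le
  obtain ⟨D, hD0, hD⟩ := hG.exists_accept_sub_le hβ.le
  obtain ⟨M, hM⟩ := hfb.bound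
  have hj1 : ∀ i, 1 ≤ j i := fun i => hc.j_pos.trans (hc.j_mono (Nat.zero_le i))
  refine hc.summable_sqrt_div hA1
    (v := fun i => ∫ ω, P.delta αs a j f x₀ i (fun m => ω (i, m)) ^ 2 ∂P.inputLaw j) ?_
  set R : ℕ → ℝ := fun i => Cf ^ 2 * (j i : ℝ) ^ (-κ) + (2 * M) ^ 2 *
    ((1 - αs) ^ a i + D / (1 - αs) / αs * (j i : ℝ) ^ (-β)) with hR
  have hle : ∀ i, ∫ ω, P.delta αs a j f x₀ (i + 1) (fun m => ω (i + 1, m)) ^ 2 ∂P.inputLaw j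
      ≤ R i := by
    intro i
    have h1 := h.integral_delta_sq_le (a := a) (j := j) (i := i)
      -- The division by `1 - αs` comes from the rescaled threshold `(α_j - αs) / (1 - αs)` for
      -- `U₂`.
      (δ := D / (1 - αs) * (j i : ℝ) ^ (-β)) (ε := Cf * (j i : ℝ) ^ (-(κ / 2)))
      (mul_nonneg (div_nonneg hD0 hα1.le) (by positivity)) (fun x ξ => ?_) hfb.measurable hM
      (hCf _ (hj1 i)) x₀
    · refine h1.trans (le_of_eq ?_)
      have h2 : ((j i : ℝ) ^ (-(κ / 2))) ^ 2 = (j i : ℝ) ^ (-κ) := by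
        rw [← Real.rpow_natCast, ← Real.rpow_mul (by positivity)]
        congr 1
        push_cast
        ring
      simp only [hR]
      rw [mul_pow, h2]
      ring
    · refine (hD _ _ (hj1 i) (hc.j_mono (Nat.le_succ i)) x ξ).trans (le_of_eq ?_)
      field_simp
  refine IsBigO.trans (IsBigO.of_bound 1 (Eventually.of_forall fun i => ?_))
    (g := R) ?_
  · rw [Real.norm_of_nonneg (integral_nonneg fun ω => sq_nonneg _), one_mul]
    exact (hle i).trans (le_abs_self _)
  · have h1 : (fun i => (j i : ℝ) ^ (-κ)) =O[atTop] fun i : ℕ => (i : ℝ) ^ (-A) :=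
      (hc.rpow_isBigO hq (-κ)).trans (isBigO_natCast_rpow (by linarith))
    have h2 : (fun i => (j i : ℝ) ^ (-β)) =O[atTop] fun i : ℕ => (i : ℝ) ^ (-A) :=
      (hc.rpow_isBigO hq (-β)).trans (isBigO_natCast_rpow (by linarith))
    have h3 := hc.pow_isBigO hcpos hqβ hAβ
    rw [neg_neg, Real.exp_log hα1] at h3
    exact (h1.const_mul_left _).add ((h3.add (h2.const_mul_left _)).const_mul_left _)

end InverseProblem

/-! ### Existence of polynomial choices -/

section Existence

/-- The law of `⌊U ^ (-1 / t)⌋` for `U` uniform on `(0, 1]`. -/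
def zetaTailLaw (t : ℝ) : Measure ℕ :=
  ((volume : Measure ℝ).restrict (Set.Ioc 0 1)).map fun u => ⌊u ^ (-t⁻¹)⌋₊

lemma measurable_floor_rpow (t : ℝ) : Measurable fun u : ℝ => ⌊u ^ (-t⁻¹)⌋₊ :=
  Nat.measurable_floor.comp (measurable_id.pow_const _)

lemma isProbabilityMeasure_zetaTailLaw (t : ℝ) : IsProbabilityMeasure (zetaTailLaw t) := by
  have : IsProbabilityMeasure ((volume : Measure ℝ).restrict (Set.Ioc 0 1)) := ⟨by simp⟩
  exact Measure.isProbabilityMeasure_map (measurable_floor_rpow t).aemeasurable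

lemma zetaTailLaw_real_Ici {t : ℝ} (ht : 0 < t) {i : ℕ} (hi : 1 ≤ i) :
    (zetaTailLaw t).real (Set.Ici i) = (i : ℝ) ^ (-t) := by
  have h1 : (1 : ℝ) ≤ i := by exact_mod_cast hi
  have h0 : (0 : ℝ) < i := by linarith
  have hpre : (fun u : ℝ => ⌊u ^ (-t⁻¹)⌋₊) ⁻¹' Set.Ici i ∩ Set.Ioc 0 1
      = Set.Ioc 0 ((i : ℝ) ^ (-t)) := by
    ext u
    simp only [Set.mem_inter_iff, Set.mem_preimage, Set.mem_Ici, Set.mem_Ioc]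
    -- Inverse transform sampling: the floor is harmless because `i` is an integer.
    have key : ∀ hu : 0 < u, (i ≤ ⌊u ^ (-t⁻¹)⌋₊ ↔ u ≤ (i : ℝ) ^ (-t)) := by
      intro hu
      rw [Nat.le_floor_iff (by positivity), Real.rpow_neg hu.le, Real.rpow_neg h0.le,
        le_inv_comm₀ h0 (by positivity), Real.rpow_inv_le_iff_of_pos hu.le (by positivity) ht,
        Real.inv_rpow h0.le]
    constructor
    · rintro ⟨h2, h3, -⟩
      exact ⟨h3, (key h3).1 h2⟩
    · rintro ⟨h2, h3⟩
      exact ⟨(key h2).2 h3, h2,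
        h3.trans (Real.rpow_le_one_of_one_le_of_nonpos h1 (by linarith))⟩
  rw [zetaTailLaw, Measure.real, Measure.map_apply (measurable_floor_rpow t) .of_discrete,
    Measure.restrict_apply (measurable_floor_rpow t .of_discrete), hpre, Real.volume_Ioc, sub_zero,
    ENNReal.toReal_ofReal (by positivity)]

lemma exists_isPolynomialChoice {β c q t : ℝ} (hβ : 0 < β) (hc : 0 < c) (hq : 0 < q)
    (ht : 0 < t) : ∃ (a j : ℕ → ℕ) (ν : Measure ℕ), IsPolynomialChoice β c q t a j ν := by
  have hk : 0 < q * β / c := by positivity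
  -- The maximum with `1` matters only at `i = 0`, where `0 ^ q = 0`; there `Real.log 0 = 0` gives
  -- `a 0 = 0`.
  refine ⟨fun i => ⌈q * β / c * Real.log i⌉₊, fun i => max 1 ⌈(i : ℝ) ^ q⌉₊, zetaTailLaw t,
    ?_, ?_, ?_, le_max_left _ _, ?_, isProbabilityMeasure_zetaTailLaw t, 1, one_pos, ?_⟩
  · intro i i' hii
    refine Nat.ceil_mono (mul_le_mul_of_nonneg_left ?_ hk.le)
    rcases Nat.eq_zero_or_pos i with rfl | hi
    · simpa using Real.log_natCast_nonneg i'
    · exact Real.log_le_log (by exact_mod_cast hi) (by exact_mod_cast hii)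
  · have hlim : Tendsto (fun i : ℕ => q * β / c * Real.log i) atTop atTop :=
      (Real.tendsto_log_atTop.comp tendsto_natCast_atTop_atTop).const_mul_atTop hk
    exact Asymptotics.isEquivalent_nat_ceil.comp_tendsto hlim
  · intro i i' hii
    exact max_le_max le_rfl (Nat.ceil_mono
      (Real.rpow_le_rpow (by positivity) (by exact_mod_cast hii) hq.le))
  · intro i hi
    have h1 : (1 : ℝ) ≤ (i : ℝ) ^ q := Real.one_le_rpow (by exact_mod_cast hi) hq.le
    have h2 : max 1 ⌈(i : ℝ) ^ q⌉₊ = ⌈(i : ℝ) ^ q⌉₊ :=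
      max_eq_right (Nat.one_le_ceil_iff.2 (by linarith))
    rw [h2, abs_of_nonneg (sub_nonneg.2 (Nat.le_ceil _))]
    linarith [Nat.ceil_lt_add_one (show 0 ≤ (i : ℝ) ^ q by linarith)]
  · intro i hi
    rw [one_mul, zetaTailLaw_real_Ici ht hi]

end Existence

theorem mainTheorem2 {d : ℕ} (P : InverseProblem d) (f : P.X → ℝ) (s : ℕ → NNReal)
    (β κ θ : ℝ) (hβ : 1 < β) (hκ : 1 < κ) (hθ : θ < min β κ)
    (hG : P.ForwardRate β)
    (hf_meas : Measurable f) (hf_bdd : ∃ M : ℝ, ∀ x, |f x| ≤ M) (hf : P.ObservableRate f κ)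
    (hs : ∃ C : ℝ, ∀ j : ℕ, 1 ≤ j → (s j : ℝ) ≤ C * (j : ℝ) ^ θ) :
    IsProbabilityMeasure P.posterior ∧
    (∃ αs : ℝ, P.IsAcceptBound αs) ∧
    ∀ αs : ℝ, P.IsAcceptBound αs →
      (∃ (a j : ℕ → ℕ) (ν : Measure ℕ), IsParameterChoice a j ν ∧ P.Works αs s f a j ν) ∧
      ∀ q : ℝ, 3 / (min β κ - θ) < q →
        1 + θ * q < min β κ * q - 2 ∧
        ∀ t ∈ Set.Ioo (1 + θ * q) (min β κ * q - 2),
          (0 < t → ∃ (a j : ℕ → ℕ) (ν : Measure ℕ),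
            IsPolynomialChoice β (-Real.log (1 - αs)) q t a j ν) ∧
          ∀ (a j : ℕ → ℕ) (ν : Measure ℕ),
            IsPolynomialChoice β (-Real.log (1 - αs)) q t a j ν →
            P.Works αs s f a j ν := by
  have hβ0 : 0 < β := by linarith
  have hrθ : 0 < min β κ - θ := sub_pos.2 hθ
  have hfb : BoundedMeasurable f := ⟨hf_meas, hf_bdd⟩
  have hgap : ∀ q, 3 / (min β κ - θ) < q → 1 + θ * q < min β κ * q - 2 := by
    intro q hq
    rw [div_lt_iff₀ hrθ] at hq
    linarith
  have hq0 : ∀ q, 3 / (min β κ - θ) < q → 0 < q := fun q hq =>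
    (div_pos three_pos hrθ).trans hq
  refine ⟨hG.isProbabilityMeasure_posterior hβ0, hG.exists_isAcceptBound hβ0.le, fun αs h => ?_⟩
  have hcpos : 0 < -Real.log (1 - αs) :=
    neg_pos.2 (Real.log_neg (by linarith [h.2.1]) (by linarith [h.1]))
  refine ⟨?_, fun q hq => ⟨hgap q hq, fun t ht =>
    ⟨exists_isPolynomialChoice hβ0 hcpos (hq0 q hq), fun a j ν hc =>
      h.works_of_isPolynomialChoice hβ0 hG hfb hf hs (hq0 q hq) ht.1 ht.2 hc⟩⟩⟩
  -- `θ` may be negative, so `t > 0` has to be arranged: `q > 2` and `min β κ > 1` make the upper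
  -- end `min β κ * q - 2` of the window positive.
  obtain ⟨q, hq⟩ := exists_gt (max (3 / (min β κ - θ)) 2)
  have hq1 : 3 / (min β κ - θ) < q := (le_max_left _ _).trans_lt hq
  have hq2 : 2 < q := (le_max_right _ _).trans_lt hq
  have hr : 1 < min β κ := lt_min hβ hκ
  obtain ⟨t, ht1, ht2⟩ := exists_between
    (max_lt (hgap q hq1) (show 0 < min β κ * q - 2 by nlinarith))
  obtain ⟨a, j, ν, hc⟩ := exists_isPolynomialChoice hβ0 hcpos (hq0 q hq1)
    ((le_max_right _ _).trans_lt ht1)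
  exact ⟨a, j, ν, hc.isParameterChoice (hq0 q hq1) (div_pos (mul_pos (hq0 q hq1) hβ0) hcpos),
    h.works_of_isPolynomialChoice hβ0 hG hfb hf hs (hq0 q hq1)
      ((le_max_left _ _).trans_lt ht1) ht2 hc⟩

end
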